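/- For a commutative ring $R$ let $\mathrm{HTP}(R)$ be the set of all polynomials $f\in\mathbb{Z}[X_0,X_1,X_2,\ldots]$ for which $f=0$ has a solution in $R$. Fix a computable bijection from $\omega$ onto $\mathbb{Z}[X_0,X_1,\ldots]$, and use it to regard each set $\mathrm{HTP}(R)$ as a subset of $\omega$. Let $\mathbb{P}$ be the set of all prime numbers, and for $W\subseteq\mathbb{P}$ let $R_W=\mathbb{Z}[\tfrac1p : p\in W]\subseteq\mathbb{Q}$. Give the power set $2^{\mathbb{P}}$ (identified with $\{0,1\}^{\mathbb{P}}$) the product topology, that is, the topology of Cantor space; a subset of $2^{\mathbb{P}}$ is meager if it is a countable union of nowhere dense sets, and comeager if its complement is meager. Then for every set $C\subseteq\omega$, the following are equivalent: 1. $C\leq_T \mathrm{HTP}(\mathbb{Q})$. 2. $\{W\subseteq\mathbb{P} : C\leq_T\mathrm{HTP}(R_W)\}=2^{\mathbb{P}}$. 3. $\{W\subseteq\mathbb{P} : C\leq_T\mathrm{HTP}(R_W)\}$ is comeager. 4. $\{W\subseteq\mathbb{P} : C\leq_T\mathrm{HTP}(R_W)\}$ is not meager. -/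

import Mathlib

open scoped Computability

noncomputable section

namespace HTPQ

/-- The characteristic function of a set of natural numbers, as an oracle. -/
def charFn (A : Set ℕ) : ℕ →. ℕ :=
  open Classical in fun n => Part.some (if n ∈ A then 1 else 0)

/-- `SetTuringReducible A B` is Turing reducibility `A ≤_T B` between sets of natural numbers:
the characteristic function of `A` is recursive in that of `B`. -/
def SetTuringReducible (A B : Set ℕ) : Prop :=
  charFn A ≤ᵀ charFn B

/-- The polynomial in `ℤ[X₀, X₁, …]` written down as a finite list of terms; the term
`(c, [i₁, …, iₖ])` stands for `c * X_{i₁} * ⋯ * X_{iₖ}`. -/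
def polyOfTerms (t : List (ℤ × List ℕ)) : MvPolynomial ℕ ℤ :=
  (t.map fun m => MvPolynomial.C m.1 * (m.2.map MvPolynomial.X).prod).sum

/-- A bijection `e` from the natural numbers onto `ℤ[X₀, X₁, …]` is computable if from `n` one
can compute an expression (a list of terms) for the polynomial `e n`, and conversely from any
expression for a polynomial one can compute its index. -/
structure IsComputableCoding (e : ℕ ≃ MvPolynomial ℕ ℤ) : Prop where
  decode : ∃ g : ℕ → List (ℤ × List ℕ), Computable g ∧ ∀ n, polyOfTerms (g n) = e n
  encode : Computable fun t : List (ℤ × List ℕ) => e.symm (polyOfTerms t)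

/-- Hilbert's Tenth Problem for a commutative ring `R`: the set of polynomials over `ℤ` in the
variables `X₀, X₁, …` (each involving only finitely many of them) which have a zero in `R`. -/
def HTP (R : Type) [CommRing R] : Set (MvPolynomial ℕ ℤ) :=
  {f | ∃ r : ℕ → R, MvPolynomial.aeval r f = 0}

/-- `HTP(R)` regarded as a set of natural numbers through the coding `e` of polynomials. -/
def HTPCodes (e : ℕ ≃ MvPolynomial ℕ ℤ) (R : Type) [CommRing R] : Set ℕ :=
  {n | e n ∈ HTP R}

/-- A set of primes is identified with its characteristic function `W : Nat.Primes → Bool`, so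
that `2^ℙ` is the space `Nat.Primes → Bool` with the product of the discrete topologies.
`subringOf W` is the subring `R_W = ℤ[1/p : p ∈ W]` of `ℚ`. -/
def subringOf (W : Nat.Primes → Bool) : Subring ℚ :=
  Subring.closure {x : ℚ | ∃ p : Nat.Primes, W p = true ∧ x = 1 / ((p : ℕ) : ℚ)}

/-- The class of all sets `W` of primes such that `C ≤_T HTP(R_W)`. -/
def computingClass (e : ℕ ≃ MvPolynomial ℕ ℤ) (C : Set ℕ) : Set (Nat.Primes → Bool) :=
  {W | SetTuringReducible C (HTPCodes e (subringOf W))}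

end HTPQ

end

namespace HTPQ

/-! The implication from 1 to 2 holds because `HTP(ℚ)` is many-one reducible to every `HTP(R_W)`: a
rational point is a tuple of integers over one common denominator, and by Lagrange's theorem a
positive denominator can be written `1 + a² + b² + c² + e²`, an expression that vanishes nowhere in
`ℚ` (`solvableIn_projTerms`). From 2 to 3 is trivial, and from 3 to 4 is the Baire category theorem.

The substance is the passage from 4 to 1. There are countably many oracle programs, so if the class
is not meager, one program computes `C` from `HTP(R_W)` for a set of `W` dense in some cylinder;
these `W` may be taken generic. To compute `C` from `HTP(ℚ)`, search for a finite list of certified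
answers about `HTP(R_W)` on which the program halts. Certificates that are consistent with the
cylinder hold for some `W` in the dense set, so the output is correct (`reducible_of_mem_closure`).
Such certificates exist because a generic `W` decides every polynomial for a finite reason
(`dense_decidedClass`).

A positive certificate is a solution. A negative one must be verifiable with `HTP(ℚ)`, although
excluding finitely many primes from denominators is not visibly Diophantine over `ℚ`. The set
`localSet r M`, defined by norm-one elements of the quaternion algebra `(r, M)`, does this: it
contains every rational whose denominator is prime to `r M` (`mem_localSet`), and for suitable `r`
only rationals whose denominator is prime to `M` (`not_dvd_den_of_mem_localSet`). The extra prime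
`r` is harmless, since it can be chosen outside any finite set and then omitted from `W`. The first
inclusion rests on Legendre's theorem, reciprocity and Dirichlet's theorem, the second on anisotropy
at the primes dividing `M`. Finally, a whole list of certificates is checked by a single query
(`not_solvableIn_queryTerms`). -/

/-! ### Legendre's theorem on ternary forms. -/

/-- **Pigeonhole step of Legendre's theorem.** -/
theorem exists_small_solution_mod {a b c : ℕ} (ha : 0 < a) (hb : 0 < b) (hc : 0 < c)
    (s₁ s₂ s₃ : ℤ) :
    ∃ x y z : ℤ, (x ≠ 0 ∨ y ≠ 0 ∨ z ≠ 0) ∧ x ^ 2 ≤ b * c ∧ y ^ 2 ≤ a * c ∧ z ^ 2 ≤ a * b ∧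
      (a : ℤ) ∣ b * y - s₁ * z ∧ (b : ℤ) ∣ a * x - s₂ * z ∧ (c : ℤ) ∣ a * x - s₃ * y := by
  classical
  have : NeZero a := ⟨ha.ne'⟩
  have : NeZero b := ⟨hb.ne'⟩
  have : NeZero c := ⟨hc.ne'⟩
  set X := Nat.sqrt (b * c)
  set Y := Nat.sqrt (a * c)
  set Z := Nat.sqrt (a * b)
  let S : Finset (ℕ × ℕ × ℕ) := Finset.range (X + 1) ×ˢ Finset.range (Y + 1) ×ˢ Finset.range (Z + 1)
  let φ : ℕ × ℕ × ℕ → ZMod a × ZMod b × ZMod c := fun p =>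
    (((b * p.2.1 - s₁ * p.2.2 : ℤ) : ZMod a), ((a * p.1 - s₂ * p.2.2 : ℤ) : ZMod b),
      ((a * p.1 - s₃ * p.2.1 : ℤ) : ZMod c))
  have hcard : (Finset.univ : Finset (ZMod a × ZMod b × ZMod c)).card < S.card := by
    simp only [Finset.card_univ, Fintype.card_prod, ZMod.card, S, Finset.card_product,
      Finset.card_range]
    have h1 : b * c < (X + 1) ^ 2 := Nat.lt_succ_sqrt' _
    have h2 : a * c < (Y + 1) ^ 2 := Nat.lt_succ_sqrt' _
    have h3 : a * b < (Z + 1) ^ 2 := Nat.lt_succ_sqrt' _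
    -- The box has more than `abc` points: `(abc)²` is the product of `bc`, `ac` and `ab`, each
    -- below the square of the corresponding side.
    refine lt_of_pow_lt_pow_left₀ 2 (Nat.zero_le _) ?_
    calc (a * (b * c)) ^ 2 = (b * c) * ((a * c) * (a * b)) := by ring
      _ < (X + 1) ^ 2 * ((Y + 1) ^ 2 * (Z + 1) ^ 2) :=
        Nat.mul_lt_mul'' h1 (Nat.mul_lt_mul'' h2 h3)
      _ = _ := by ring
  obtain ⟨p, hp, q, hq, hne, heq⟩ := Finset.exists_ne_map_eq_of_card_lt_of_maps_to hcard
    (f := φ) (fun _ _ => Finset.mem_coe.2 (Finset.mem_univ _))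
  obtain ⟨p1, p2, p3⟩ := p
  obtain ⟨q1, q2, q3⟩ := q
  simp only [S, Finset.mem_product, Finset.mem_range, Nat.lt_succ_iff] at hp hq
  simp only [φ, Prod.mk.injEq, ZMod.intCast_eq_intCast_iff_dvd_sub] at heq
  have bound : ∀ {u v n : ℕ}, u ≤ Nat.sqrt n → v ≤ Nat.sqrt n → ((v : ℤ) - u) ^ 2 ≤ n := by
    intro u v n hu hv
    have h : |(v : ℤ) - u| ≤ (Nat.sqrt n : ℤ) := by rw [abs_le]; constructor <;> omega
    calc ((v : ℤ) - u) ^ 2 = |(v : ℤ) - u| ^ 2 := (sq_abs _).symm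
      _ ≤ (Nat.sqrt n : ℤ) ^ 2 := by gcongr
      _ ≤ n := by exact_mod_cast Nat.sqrt_le' n
  refine ⟨(q1 : ℤ) - p1, (q2 : ℤ) - p2, (q3 : ℤ) - p3, ?_, ?_, ?_, ?_, ?_, ?_, ?_⟩
  · by_contra h
    push Not at h
    apply hne
    simp only [Prod.mk.injEq]
    omega
  · exact_mod_cast bound hp.1 hq.1
  · exact_mod_cast bound hp.2.1 hq.2.1
  · exact_mod_cast bound hp.2.2 hq.2.2
  · convert heq.1 using 1; ring
  · convert heq.2.1 using 1; ring
  · convert heq.2.2 using 1; ring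

/-- **Legendre's theorem** on the isotropy of `a x² + b y² - c z²`. -/
theorem exists_isotropic_of_residues {a b c : ℕ} (ha : 0 < a) (hb : 0 < b) (hc : 0 < c)
    (cab : a.Coprime b) (cac : a.Coprime c) (cbc : b.Coprime c)
    (hab : ¬ IsSquare (a * b)) (hbc : ¬ IsSquare (b * c))
    (h₁ : ∃ s : ℤ, (a : ℤ) ∣ s ^ 2 - b * c) (h₂ : ∃ s : ℤ, (b : ℤ) ∣ s ^ 2 - a * c)
    (h₃ : ∃ s : ℤ, (c : ℤ) ∣ s ^ 2 + a * b) :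
    ∃ x y z : ℤ, (x ≠ 0 ∨ y ≠ 0 ∨ z ≠ 0) ∧ a * x ^ 2 + b * y ^ 2 = c * z ^ 2 := by
  obtain ⟨s₁, hs₁⟩ := h₁
  obtain ⟨s₂, hs₂⟩ := h₂
  obtain ⟨s₃, hs₃⟩ := h₃
  obtain ⟨x, y, z, hne, hx, hy, hz, d₁, d₂, d₃⟩ := exists_small_solution_mod ha hb hc s₁ s₂ s₃
  have iab : IsCoprime (a : ℤ) b := Nat.isCoprime_iff_coprime.2 cab
  have iac : IsCoprime (a : ℤ) c := Nat.isCoprime_iff_coprime.2 cac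
  have ibc : IsCoprime (b : ℤ) c := Nat.isCoprime_iff_coprime.2 cbc
  set f : ℤ := a * x ^ 2 + b * y ^ 2 - c * z ^ 2 with hf
  have da : (a : ℤ) ∣ f := by
    refine iab.dvd_of_dvd_mul_left ?_
    have : b * f = (b * y - s₁ * z) * (b * y + s₁ * z) + (s₁ ^ 2 - b * c) * z ^ 2
        + a * (b * x ^ 2) := by rw [hf]; ring
    rw [this]
    exact dvd_add (dvd_add (d₁.mul_right _) (hs₁.mul_right _)) (dvd_mul_right _ _)
  have db : (b : ℤ) ∣ f := by
    refine iab.symm.dvd_of_dvd_mul_left ?_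
    have : a * f = (a * x - s₂ * z) * (a * x + s₂ * z) + (s₂ ^ 2 - a * c) * z ^ 2
        + b * (a * y ^ 2) := by rw [hf]; ring
    rw [this]
    exact dvd_add (dvd_add (d₂.mul_right _) (hs₂.mul_right _)) (dvd_mul_right _ _)
  have dc : (c : ℤ) ∣ f := by
    refine iac.symm.dvd_of_dvd_mul_left ?_
    have : a * f = (a * x - s₃ * y) * (a * x + s₃ * y) + (s₃ ^ 2 + a * b) * y ^ 2
        - c * (a * z ^ 2) := by rw [hf]; ring
    rw [this]
    exact dvd_sub (dvd_add (d₃.mul_right _) (hs₃.mul_right _)) (dvd_mul_right _ _)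
  obtain ⟨k, hk⟩ : (a * b * c : ℤ) ∣ f :=
    IsCoprime.mul_dvd (iac.mul_left ibc) (iab.mul_dvd da db) dc
  have ha' : (0 : ℤ) < a := by exact_mod_cast ha
  have hb' : (0 : ℤ) < b := by exact_mod_cast hb
  have hc' : (0 : ℤ) < c := by exact_mod_cast hc
  have habc : (0 : ℤ) < a * b * c := by positivity
  have ex : a * x ^ 2 ≤ (a * b * c : ℤ) := by nlinarith
  have ey : b * y ^ 2 ≤ (a * b * c : ℤ) := by nlinarith
  have ez : c * z ^ 2 ≤ (a * b * c : ℤ) := by nlinarith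
  have px : 0 ≤ a * x ^ 2 := by positivity
  have py : 0 ≤ b * y ^ 2 := by positivity
  have pz : 0 ≤ c * z ^ 2 := by positivity
  have sqnat : ∀ {n : ℕ} {t : ℤ}, t ^ 2 = n → IsSquare n := by
    intro n t h
    exact ⟨t.natAbs, by zify; rw [← h, ← sq, sq_abs]⟩
  -- The size bounds leave `-1 ≤ k ≤ 2`. The extreme values force `x² = bc` or `z² = ab`, which the
  -- nonsquare hypotheses exclude.
  have k2 : k < 2 := by
    by_contra hk2
    push Not at hk2
    have h2 : 2 * (a * b * c : ℤ) ≤ f := by rw [hk]; nlinarith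
    have : a * x ^ 2 = a * (b * c : ℤ) := by linarith
    exact hbc (sqnat (t := x) (by push_cast; exact mul_left_cancel₀ ha'.ne' this))
  have k1 : -1 < k := by
    by_contra hk2
    push Not at hk2
    have h2 : f ≤ -(a * b * c : ℤ) := by rw [hk]; nlinarith
    have : c * z ^ 2 = c * (a * b : ℤ) := by linarith
    exact hab (sqnat (t := z) (by push_cast; exact mul_left_cancel₀ hc'.ne' this))
  have k01 : k = 0 ∨ k = 1 := by omega
  rcases k01 with rfl | rfl
  · exact ⟨x, y, z, hne, by linarith⟩
  -- If `k = 1`, then `a x² + b y² = c (z² + ab)`. Multiplying by `z² + ab` and using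
  -- multiplicativity of the norm form `u² + ab v²` gives an honest zero.
  · refine ⟨x * z + b * y, y * z - a * x, z ^ 2 + a * b, Or.inr (Or.inr (by positivity)), ?_⟩
    have h : a * x ^ 2 + b * y ^ 2 = c * (z ^ 2 + a * b : ℤ) := by linarith
    linear_combination (z ^ 2 + a * b : ℤ) * h

theorem not_isSquare_mul_prime {n l : ℕ} (hl : l.Prime) (h : ¬ l ∣ n) : ¬ IsSquare (n * l) := by
  rintro ⟨k, hk⟩
  have hlk : l ∣ k := by
    have : l ∣ k * k := ⟨n, by rw [← hk, mul_comm]⟩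
    exact (hl.dvd_mul.1 this).elim id id
  obtain ⟨j, rfl⟩ := hlk
  apply h
  refine ⟨j * j, Nat.eq_of_mul_eq_mul_right hl.pos ?_⟩
  rw [hk]; ring

theorem eq_zero_of_mul_sq_eq_sq {n : ℕ} (hn : ¬ IsSquare n) {x z : ℤ}
    (h : (n : ℤ) * x ^ 2 = z ^ 2) : x = 0 := by
  by_contra hx
  apply hn
  have hx' : (x : ℚ) ≠ 0 := by exact_mod_cast hx
  have h' : (n : ℚ) * x ^ 2 = z ^ 2 := by exact_mod_cast h
  rw [← Rat.isSquare_natCast_iff]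
  exact ⟨z / x, by field_simp; linarith⟩

theorem isSquare_left_of_coprime {a b : ℕ} (h : a.Coprime b) (hs : IsSquare (a * b)) :
    IsSquare a := by
  obtain ⟨c, hc⟩ := hs
  obtain ⟨d, hd⟩ := exists_associated_pow_of_mul_eq_pow (a := a) (b := b) (c := c) (k := 2)
    (by rw [Nat.isUnit_iff]; exact h) (by rw [hc, sq])
  rw [associated_iff_eq] at hd
  exact ⟨d, by rw [← hd, sq]⟩

theorem exists_int_sq_sub_dvd_of_jacobiSym {l : ℕ} (hl : l.Prime) {a : ℤ}
    (h : jacobiSym a l = 1) : ∃ s : ℤ, (l : ℤ) ∣ s ^ 2 - a := by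
  have : Fact l.Prime := ⟨hl⟩
  obtain ⟨t, ht⟩ := ZMod.isSquare_of_jacobiSym_eq_one h
  refine ⟨(t.val : ℤ), ?_⟩
  rw [← ZMod.intCast_eq_intCast_iff_dvd_sub, Int.cast_pow, Int.cast_natCast, ZMod.natCast_zmod_val,
    ht, sq]

/-! ### Norms and values of ternary forms, through an auxiliary prime. -/

/-- A prime congruent to `1` modulo `4 r`, where `r ≡ 1 (mod 4)`, is a norm from `ℚ(√r)`. -/
theorem prime_eq_norm {l r : ℕ} (hl : l.Prime) (hr4 : r % 4 = 1) (hr : ¬ IsSquare r)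
    (hlr : l ≡ 1 [MOD 4 * r]) (hlt : r < l) :
    ∃ x y : ℚ, (l : ℚ) = x ^ 2 - r * y ^ 2 := by
  have hr0 : 0 < r := by omega
  have hnd : ¬ l ∣ r := fun h => absurd (Nat.le_of_dvd hr0 h) (by omega)
  have hl4 : l % 4 = 1 := (Nat.ModEq.of_mul_right r hlr : l ≡ 1 [MOD 4])
  have hlodd : Odd l := Nat.odd_iff.2 (by omega)
  -- By reciprocity the symbol depends only on `l` modulo `4 r`.
  have hj : jacobiSym (r : ℤ) l = 1 := by
    rw [jacobiSym.mod_right' r hlodd, hlr, ← jacobiSym.mod_right' r odd_one, jacobiSym.one_right]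
  obtain ⟨x, y, z, hne, h⟩ := exists_isotropic_of_residues (a := r) (b := l) (c := 1) hr0 hl.pos
    one_pos ((Nat.Prime.coprime_iff_not_dvd hl).2 hnd).symm (Nat.coprime_one_right _)
    (Nat.coprime_one_right _) (not_isSquare_mul_prime hl hnd)
    (by rw [mul_comm]; exact not_isSquare_mul_prime hl (by simpa using hl.ne_one))
    ⟨1, by
      have h1 : (4 * r : ℤ) ∣ 1 - l := by exact_mod_cast hlr.dvd
      have := (Dvd.intro_left 4 rfl : (r : ℤ) ∣ 4 * r).trans h1
      simpa using this⟩
    (by simpa using exists_int_sq_sub_dvd_of_jacobiSym hl hj) ⟨0, by simp⟩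
  have hy : y ≠ 0 := by
    rintro rfl
    have h' : (r : ℤ) * x ^ 2 = z ^ 2 := by simpa using h
    have hx := eq_zero_of_mul_sq_eq_sq hr h'
    subst hx
    have : z = 0 := by simpa using h'.symm
    simp [this] at hne
  have hy' : (y : ℚ) ≠ 0 := by exact_mod_cast hy
  refine ⟨z / y, x / y, ?_⟩
  have hq : (r : ℚ) * x ^ 2 + l * y ^ 2 = z ^ 2 := by
    have : (r : ℤ) * x ^ 2 + l * y ^ 2 = z ^ 2 := by simpa using h
    exact_mod_cast this
  field_simp
  linarith

/-- Legendre's theorem as proved wants two positive coefficients against one. The sign of `m`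
decides whether `l` or `M` is the isolated one; the three residue conditions are permuted
accordingly. -/
theorem exists_isotropic_signed {M l : ℕ} {m : ℤ} (hl : l.Prime) (hM : 0 < M) (hm : m ≠ 0)
    (cMm : IsCoprime (M : ℤ) m) (hlM : ¬ l ∣ M) (hlm : ¬ (l : ℤ) ∣ m) (hMs : ¬ IsSquare M)
    (h₁ : ∃ s : ℤ, m ∣ s ^ 2 - M * l) (h₂ : ∃ s : ℤ, (M : ℤ) ∣ s ^ 2 - m * l)
    (h₃ : ∃ s : ℤ, (l : ℤ) ∣ s ^ 2 + m * M) :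
    ∃ w z t : ℤ, (w ≠ 0 ∨ z ≠ 0 ∨ t ≠ 0) ∧ m * w ^ 2 + M * z ^ 2 = l * t ^ 2 := by
  have hlM' : l.Coprime M := (Nat.Prime.coprime_iff_not_dvd hl).2 hlM
  obtain ⟨n, rfl | rfl⟩ := m.eq_nat_or_neg
  · have hn : 0 < n := Nat.pos_of_ne_zero (by rintro rfl; simp at hm)
    have cnM : M.Coprime n := Nat.isCoprime_iff_coprime.1 cMm
    have hln : ¬ l ∣ n := fun h => hlm (by exact_mod_cast h)
    have hln' : l.Coprime n := (Nat.Prime.coprime_iff_not_dvd hl).2 hln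
    obtain ⟨x, y, z, hne, h⟩ := exists_isotropic_of_residues hn hM hl.pos cnM.symm hln'.symm
      hlM'.symm (fun h => hMs (isSquare_left_of_coprime cnM (by rwa [mul_comm])))
      (not_isSquare_mul_prime hl hlM) h₁ h₂ h₃
    exact ⟨x, y, z, hne, h⟩
  · have hn : 0 < n := Nat.pos_of_ne_zero (by rintro rfl; simp at hm)
    have cnM : M.Coprime n := Nat.isCoprime_iff_coprime.1 ((IsCoprime.neg_right_iff _ _).1 cMm)
    have hln : ¬ l ∣ n := fun h => hlm (by rw [dvd_neg]; exact_mod_cast h)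
    have hln' : l.Coprime n := (Nat.Prime.coprime_iff_not_dvd hl).2 hln
    obtain ⟨x, y, z, hne, h⟩ := exists_isotropic_of_residues hl.pos hn hM hln' hlM' cnM.symm
      (by rw [mul_comm]; exact not_isSquare_mul_prime hl hln)
      (fun h => hMs (isSquare_left_of_coprime cnM (by rwa [mul_comm])))
      (h₃.imp fun s hs => by convert hs using 1; ring)
      (h₁.imp fun s hs => by rw [neg_dvd] at hs; rwa [mul_comm (l : ℤ)])
      (h₂.imp fun s hs => by convert hs using 1; ring)
    refine ⟨y, z, x, by tauto, by linarith⟩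

/-- The ternary form `x² - r y² - M z²` represents `b² - r M a²` over `ℚ`, when `b` is prime to
`a r M` and `r ≡ 1 (mod 4)`. -/
theorem exists_ternary_rep {r M : ℕ} (hr4 : r % 4 = 1) (hM : 0 < M) (hrM : r.Coprime M)
    {a b : ℤ} (hab : IsCoprime a b) (hb : IsCoprime b (r * M)) :
    ∃ x y z : ℚ, x ^ 2 - r * y ^ 2 - M * z ^ 2 = b ^ 2 - r * M * a ^ 2 := by
  -- If `r` or `M` is a square, the ternary form contains a hyperbolic plane and represents
  -- everything.
  have hyp : ∀ s t : ℚ, s ≠ 0 → ∃ u v : ℚ, u ^ 2 - s ^ 2 * v ^ 2 = t := by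
    intro s t hs
    exact ⟨(t + 1) / 2, (t - 1) / (2 * s), by field_simp; ring⟩
  have hr0 : 0 < r := by omega
  by_cases hrs : IsSquare r
  · obtain ⟨s, rfl⟩ := hrs
    have hs : (s : ℚ) ≠ 0 := by
      have : s ≠ 0 := by rintro rfl; simp at hr0
      exact_mod_cast this
    obtain ⟨u, v, h⟩ := hyp s (b ^ 2 - ((s * s : ℕ) : ℚ) * M * a ^ 2) hs
    exact ⟨u, v, 0, by rw [← h]; push_cast; ring⟩
  by_cases hMs : IsSquare M
  · obtain ⟨s, rfl⟩ := hMs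
    have hs : (s : ℚ) ≠ 0 := by
      have : s ≠ 0 := by rintro rfl; simp at hM
      exact_mod_cast this
    obtain ⟨u, v, h⟩ := hyp s (b ^ 2 - r * ((s * s : ℕ) : ℚ) * a ^ 2) hs
    exact ⟨u, 0, v, by rw [← h]; push_cast; ring⟩
  set m : ℤ := b ^ 2 - r * M * a ^ 2 with hm
  by_cases hm0 : m = 0
  · refine ⟨0, 0, 0, ?_⟩
    have : ((b ^ 2 - r * M * a ^ 2 : ℤ) : ℚ) = 0 := by rw [← hm, hm0]; simp
    push_cast at this
    rw [this]; ring
  have cmrM : IsCoprime m (r * M) := by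
    have := (hb.pow_left (m := 2)).add_mul_left_left (-a ^ 2)
    rwa [show b ^ 2 + r * M * -a ^ 2 = m by rw [hm]; ring] at this
  have cmr : IsCoprime m r := cmrM.of_mul_right_left
  have cmM : IsCoprime m M := cmrM.of_mul_right_right
  have cam : IsCoprime a m := by
    have := (hab.pow_right (n := 2)).add_mul_left_right (-r * M * a)
    rwa [show b ^ 2 + a * (-r * M * a) = m by rw [hm]; ring] at this
  have hma : 0 < m.natAbs := Int.natAbs_pos.2 hm0
  have cmr' : r.Coprime m.natAbs := by
    have := Int.isCoprime_iff_gcd_eq_one.1 cmr.symm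
    simpa [Int.gcd] using this
  have cmrM' : (M * r).Coprime m.natAbs := by
    have := Int.isCoprime_iff_gcd_eq_one.1 cmrM.symm
    rw [mul_comm]
    simpa [Int.gcd, Int.natAbs_mul] using this
  -- The auxiliary prime `l` is to be `1` modulo `4 M r` and `r` modulo `4 m`. The moduli share
  -- exactly the factor `4`, so compatibility is the hypothesis `r ≡ 1 (mod 4)`. Then `l` is a norm
  -- from `ℚ(√r)`, and it suffices to solve `m w² + M z² = l u²`.
  obtain ⟨k, hk1, hk2⟩ := Nat.chineseRemainder' (n := 4 * (M * r)) (m := 4 * m.natAbs) (a := 1)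
    (b := r) (by
      rw [Nat.gcd_mul_left, cmrM'.gcd_eq_one, mul_one]
      exact (show 1 % 4 = r % 4 by omega))
  have ck : k.Coprime (4 * (M * r) * (4 * m.natAbs)) := by
    refine Nat.Coprime.mul_right ?_ ?_
    · rw [Nat.Coprime, hk1.gcd_eq]; simp
    · rw [Nat.Coprime, hk2.gcd_eq]
      refine Nat.Coprime.mul_right ?_ cmr'
      rw [Nat.Coprime, Nat.gcd_comm, Nat.gcd_rec, hr4]; simp
  obtain ⟨l, hlt, hl, hlk⟩ := Nat.forall_exists_prime_gt_and_modEq (r + M + m.natAbs)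
    (q := 4 * (M * r) * (4 * m.natAbs)) (by positivity) ck
  have hl1 : l ≡ 1 [MOD 4 * (M * r)] := (hlk.of_mul_right _).trans hk1
  have hl2 : l ≡ r [MOD 4 * m.natAbs] := (hlk.of_mul_left _).trans hk2
  have hl4 : l % 4 = 1 := (Nat.ModEq.of_mul_right (M * r) hl1 : l ≡ 1 [MOD 4])
  have hlodd : Odd l := Nat.odd_iff.2 (by omega)
  have hrodd : Odd r := Nat.odd_iff.2 (by omega)
  have hl1r : l ≡ 1 [MOD 4 * r] := Nat.ModEq.of_mul_right M (by convert hl1 using 1; ring)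
  have hl1M : l ≡ 1 [MOD 4 * M] := Nat.ModEq.of_mul_right r (by convert hl1 using 1; ring)
  obtain ⟨x₀, y₀, h₀⟩ := prime_eq_norm hl hr4 hrs hl1r (by omega)
  have jM : jacobiSym (M : ℤ) l = 1 := by
    rw [jacobiSym.mod_right' M hlodd, hl1M, ← jacobiSym.mod_right' M odd_one, jacobiSym.one_right]
  -- Reciprocity turns `(m/l)` into `(m/r)`, and `m ≡ b²` modulo `r`.
  have jm : jacobiSym m l = 1 := by
    rw [jacobiSym.mod_right m hlodd, hl2, ← jacobiSym.mod_right m hrodd]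
    have : m % r = b ^ 2 % r := by
      refine Int.ModEq.symm (Int.modEq_iff_dvd.2 ⟨-(M * a ^ 2), ?_⟩)
      rw [hm]; ring
    rw [jacobiSym.mod_left' this]
    exact jacobiSym.sq_one' (Int.isCoprime_iff_gcd_eq_one.1 hb.of_mul_right_left)
  have jneg : jacobiSym (-1) l = 1 := by
    rw [jacobiSym.at_neg_one hlodd, ZMod.χ₄_nat_one_mod_four hl4]
  have hlM : ¬ l ∣ M := fun h => absurd (Nat.le_of_dvd hM h) (by omega)
  have hlm : ¬ (l : ℤ) ∣ m := fun h =>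
    absurd (Nat.le_of_dvd hma (Int.natCast_dvd.1 h)) (by omega)
  obtain ⟨j, hj⟩ : m ∣ l - r := by
    have h : ((4 * m.natAbs : ℕ) : ℤ) ∣ (l : ℤ) - r := hl2.symm.dvd
    push_cast at h
    exact (dvd_abs m m |>.2 dvd_rfl |>.trans (Dvd.intro_left 4 rfl)).trans h
  obtain ⟨i, hi⟩ : (M : ℤ) ∣ l - 1 := by
    have h : ((4 * M : ℕ) : ℤ) ∣ (l : ℤ) - (1 : ℕ) := hl1M.symm.dvd
    push_cast at h
    exact (Dvd.intro_left 4 rfl).trans h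
  -- With `a'` an inverse of `a` modulo `m`, the relation `r M a² ≡ b²` makes `b a'` a square root
  -- of `r M ≡ M l` modulo `m`. Modulo `M`, where `m ≡ b²` and `l ≡ 1`, the root of `m l` is `b`.
  obtain ⟨a', t, hat⟩ := cam
  obtain ⟨w, z, u, hne, h⟩ := exists_isotropic_signed hl hM hm0 cmM.symm hlM hlm hMs
    ⟨b * a', a' ^ 2 + r * M * (-2 * t + m * t ^ 2) - M * j, by
      have e1 : b ^ 2 = m + r * M * a ^ 2 := by rw [hm]; ring
      have e2 : (l : ℤ) = r + m * j := by linarith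
      have e3 : a' * a = 1 - t * m := by linarith
      rw [mul_pow, e1, e2]
      linear_combination (r * M * (a' * a + 1 - t * m)) * e3⟩
    ⟨b, -(b ^ 2 * i) + r * a ^ 2 * l, by
      have e2 : (l : ℤ) = 1 + M * i := by linarith
      rw [hm]
      linear_combination (-b ^ 2) * e2⟩
    (by
      obtain ⟨s, hs⟩ := exists_int_sq_sub_dvd_of_jacobiSym hl (a := -1 * (m * M))
        (by rw [jacobiSym.mul_left, jacobiSym.mul_left, jneg, jm, jM]; norm_num)
      exact ⟨s, by convert hs using 1; ring⟩)
  have hw : w ≠ 0 := by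
    rintro rfl
    have hMl := not_isSquare_mul_prime hl hlM
    have hu : u = 0 := eq_zero_of_mul_sq_eq_sq (z := M * z) hMl (by
      push_cast; linear_combination (-(M : ℤ)) * h)
    subst hu
    have : z = 0 := by
      have : (M : ℤ) * z ^ 2 = 0 := by linarith
      simpa [hM.ne'] using this
    simp [this] at hne
  have hw' : (w : ℚ) ≠ 0 := by exact_mod_cast hw
  have hq : ((b : ℚ) ^ 2 - r * M * a ^ 2) * w ^ 2 + M * z ^ 2 = l * u ^ 2 := by
    have := congrArg (Int.cast : ℤ → ℚ) h
    rw [hm] at this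
    push_cast at this
    exact this
  -- Solve `m w² = l u² - M z²` for `m`, with `l` replaced by `x₀² - r y₀²`.
  refine ⟨x₀ * u / w, y₀ * u / w, z / w, ?_⟩
  rw [h₀] at hq
  field_simp
  linear_combination -hq

/-! ### Diophantine sets that control denominators at finitely many primes. -/

/-- The rationals `n` for which `n²` is a coordinate of a rational quaternion of norm `1` in the
quaternion algebra `(r, M)`. -/
def localSet (r M : ℕ) : Set ℚ :=
  {n | ∃ x y z : ℚ, x ^ 2 - r * y ^ 2 - M * z ^ 2 + r * M * n ^ 4 = 1}

/-- After clearing denominators, membership asks that `den⁴ - r M num⁴` be a value of the ternary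
form, which is `exists_ternary_rep` with `a = num²` and `b = den²`. -/
theorem mem_localSet {r M : ℕ} (hr4 : r % 4 = 1) (hM : 0 < M) (hrM : r.Coprime M) {n : ℚ}
    (hn : n.den.Coprime (r * M)) : n ∈ localSet r M := by
  have hd : (n.den : ℚ) ≠ 0 := by exact_mod_cast n.den_nz
  obtain ⟨x, y, z, h⟩ := exists_ternary_rep (a := n.num ^ 2) (b := n.den ^ 2) hr4 hM hrM
    ((Rat.isCoprime_num_den n).pow)
    (by exact_mod_cast (Nat.isCoprime_iff_coprime.2 hn).pow_left)
  refine ⟨x / n.den ^ 2, y / n.den ^ 2, z / n.den ^ 2, ?_⟩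
  have hn4 : n ^ 4 = n.num ^ 4 / n.den ^ 4 := by
    rw [← div_pow, Rat.num_div_den]
  rw [hn4]
  push_cast at h
  field_simp
  linear_combination h

theorem zero_mem_localSet (r M : ℕ) : (0 : ℚ) ∈ localSet r M := ⟨1, 0, 0, by norm_num⟩

/-- For `r ≡ 5 (mod 8)` the extension `ℚ₂(√r)` is unramified, so norms have even 2-adic valuation.
This is the part of that fact visible modulo `16`. -/
theorem norm_form_emod {r : ℕ} (hr : r % 8 = 5) (x y : ℤ) :
    (x ^ 2 - r * y ^ 2) % 2 = 1 ∨ (x ^ 2 - r * y ^ 2) % 8 = 4 ∨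
      (2 ∣ x ∧ 2 ∣ y ∧ ((x ^ 2 - r * y ^ 2) % 16 = 0 ∨ (x ^ 2 - r * y ^ 2) % 8 = 4)) := by
  obtain ⟨t, ht⟩ : ∃ t : ℤ, (r : ℤ) = 8 * t + 5 := ⟨r / 8, by omega⟩
  rw [ht]
  have hdecomp : ∀ u : ℤ, (∃ v, u = 4 * v) ∨ (∃ v, u = 4 * v + 2) ∨ (∃ v, u ^ 2 = 8 * v + 1) := by
    intro u
    have h : u % 4 = 0 ∨ u % 4 = 2 ∨ u % 2 = 1 := by omega
    rcases h with h | h | h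
    · exact Or.inl ⟨u / 4, by omega⟩
    · exact Or.inr (Or.inl ⟨u / 4, by omega⟩)
    · refine Or.inr (Or.inr ?_)
      obtain ⟨v, hv⟩ : (8 : ℤ) ∣ u ^ 2 - 1 := Int.eight_dvd_sq_sub_one_of_odd (Int.odd_iff.2 h)
      exact ⟨v, by omega⟩
  rcases hdecomp x with ⟨a, rfl⟩ | ⟨a, rfl⟩ | ⟨a, ha⟩ <;>
    rcases hdecomp y with ⟨b, rfl⟩ | ⟨b, rfl⟩ | ⟨b, hb⟩
  · refine Or.inr (Or.inr ⟨⟨2 * a, by ring⟩, ⟨2 * b, by ring⟩, Or.inl ?_⟩)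
    ring_nf; omega
  · refine Or.inr (Or.inr ⟨⟨2 * a, by ring⟩, ⟨2 * b + 1, by ring⟩, Or.inr ?_⟩)
    ring_nf; omega
  · left; rw [hb]; ring_nf; omega
  · refine Or.inr (Or.inr ⟨⟨2 * a + 1, by ring⟩, ⟨2 * b, by ring⟩, Or.inr ?_⟩)
    ring_nf; omega
  · refine Or.inr (Or.inr ⟨⟨2 * a + 1, by ring⟩, ⟨2 * b + 1, by ring⟩, Or.inl ?_⟩)
    ring_nf; omega
  · left; rw [hb]; ring_nf; omega
  · left; rw [ha]; ring_nf; omega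
  · left; rw [ha]; ring_nf; omega
  · right; left; rw [ha, hb]; ring_nf; omega

/-- Anisotropy of the norm form of `(r, M)` at a prime `p ∣ M`, in the form of a descent step. -/
theorem dvd_of_sq_dvd {r M p : ℕ} (hp : p.Prime) (hM : Squarefree M) (hpM : p ∣ M)
    (hr8 : r % 8 = 5) (hnr : p ≠ 2 → jacobiSym r p = -1) {X Y Z A B : ℤ}
    (h : X ^ 2 - r * Y ^ 2 - M * Z ^ 2 + r * M * A ^ 2 = B ^ 2) (hB : (p : ℤ) ^ 2 ∣ B) :
    (p : ℤ) ∣ X ∧ (p : ℤ) ∣ Y ∧ (p : ℤ) ∣ Z ∧ (p : ℤ) ∣ A := by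
  obtain ⟨N, rfl⟩ := hpM
  obtain ⟨C, rfl⟩ := hB
  have hpN : ¬ p ∣ N := fun hd => by
    have := hM p (mul_dvd_mul_left p hd)
    exact hp.one_lt.ne' (Nat.isUnit_iff.1 this)
  by_cases hp2 : p = 2
  · subst hp2
    push_cast at h ⊢
    have hN : ((N : ℤ)) % 2 = 1 := by omega
    have key : X ^ 2 - r * Y ^ 2 = 2 * (N * (Z ^ 2 - r * A ^ 2)) + 16 * C ^ 2 := by
      linear_combination h
    -- Both `X² - r Y²` and `q = Z² - r A²` have even valuation if below `4`, but `key` makes the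
    -- former `2 N q` modulo `16` with `N` odd. Hence `16 ∣ q`, and all four variables are even.
    -- Divisibility of `B` by `2` alone would not do: `(3/2)² - 5 (1/2)² = 1`.
    have h1 := norm_form_emod hr8 X Y
    have h2 := norm_form_emod hr8 Z A
    rw [key] at h1
    generalize Z ^ 2 - r * A ^ 2 = q at *
    obtain ⟨k, hk⟩ : ∃ k : ℤ, (N : ℤ) = 2 * k + 1 := ⟨N / 2, by omega⟩
    rw [hk] at h1
    have hq4 : q % 8 = 4 → ((2 * k + 1) * q) % 8 = 4 := by
      intro hq
      obtain ⟨v, rfl⟩ : ∃ v, q = 8 * v + 4 := ⟨q / 8, by omega⟩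
      ring_nf; omega
    have hq1 : q % 2 = 1 → ((2 * k + 1) * q) % 2 = 1 := by
      intro hq
      obtain ⟨v, rfl⟩ : ∃ v, q = 2 * v + 1 := ⟨q / 2, by omega⟩
      ring_nf; omega
    have hq0 : q % 16 = 0 → ((2 * k + 1) * q) % 16 = 0 := by
      intro hq
      obtain ⟨v, rfl⟩ : ∃ v, q = 16 * v := ⟨q / 16, by omega⟩
      ring_nf; omega
    generalize (2 * k + 1) * q = w at *
    omega
  · have hj := hnr hp2
    have : Fact p.Prime := ⟨hp⟩
    have hp0 : (p : ℤ) ≠ 0 := by exact_mod_cast hp.ne_zero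
    -- Since `r` is a nonresidue, `p ∣ u² - r v²` forces `p ∣ u` and `p ∣ v`. After division by `p`,
    -- the same applies to the other pair, as `M` contains `p` only once.
    have hXY : (p : ℤ) ∣ X ∧ (p : ℤ) ∣ Y := by
      refine jacobiSym.prime_dvd_of_eq_neg_one hj ⟨N * (Z ^ 2 - r * A ^ 2) + p ^ 3 * C ^ 2, ?_⟩
      push_cast at h
      linear_combination h
    obtain ⟨⟨x, rfl⟩, ⟨y, rfl⟩⟩ := hXY
    have hZA : (p : ℤ) ∣ N * (Z ^ 2 - r * A ^ 2) := by
      refine ⟨x ^ 2 - r * y ^ 2 - p ^ 2 * C ^ 2, ?_⟩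
      apply mul_left_cancel₀ hp0
      push_cast at h
      linear_combination -h
    have hZA' : (p : ℤ) ∣ Z ^ 2 - r * A ^ 2 := by
      rcases (Nat.prime_iff_prime_int.1 hp).dvd_or_dvd hZA with hd | hd
      · exact absurd (by exact_mod_cast hd) hpN
      · exact hd
    exact ⟨dvd_mul_right _ _, dvd_mul_right _ _, jacobiSym.prime_dvd_of_eq_neg_one hj hZA'⟩

/-- Write the coordinates over a common denominator `B`. As long as `p² ∣ B`, everything can be
divided by `p`, so `n²` equals a fraction whose denominator is not divisible by `p²`. Using `n²`
instead of `n` as coordinate absorbs the single factor `p` that may remain. -/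
theorem not_dvd_den_of_mem_localSet {r M p : ℕ} (hp : p.Prime) (hM : Squarefree M) (hpM : p ∣ M)
    (hr8 : r % 8 = 5) (hnr : p ≠ 2 → jacobiSym r p = -1) {n : ℚ} (hn : n ∈ localSet r M) :
    ¬ p ∣ n.den := by
  have hp0 : (p : ℤ) ≠ 0 := by exact_mod_cast hp.ne_zero
  have descent : ∀ k : ℕ, ∀ X Y Z A B : ℤ, B.natAbs = k → B ≠ 0 →
      X ^ 2 - r * Y ^ 2 - M * Z ^ 2 + r * M * A ^ 2 = B ^ 2 →
      ∃ A' B' : ℤ, ¬ (p : ℤ) ^ 2 ∣ B' ∧ A * B' = A' * B := by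
    intro k
    induction k using Nat.strong_induction_on with
    | _ k ih =>
      intro X Y Z A B hk hB h
      by_cases hd : (p : ℤ) ^ 2 ∣ B
      · obtain ⟨⟨x, rfl⟩, ⟨y, rfl⟩, ⟨z, rfl⟩, ⟨a, rfl⟩⟩ := dvd_of_sq_dvd hp hM hpM hr8 hnr h hd
        obtain ⟨b, rfl⟩ := (dvd_pow_self (p : ℤ) two_ne_zero).trans hd
        have hb : b ≠ 0 := by rintro rfl; simp at hB
        obtain ⟨A', B', hB', hAB⟩ := ih b.natAbs (by
          rw [← hk, Int.natAbs_mul, Int.natAbs_natCast]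
          exact lt_mul_of_one_lt_left (Int.natAbs_pos.2 hb) hp.one_lt) x y z a b rfl hb (by
            apply mul_left_cancel₀ (pow_ne_zero 2 hp0)
            linear_combination h)
        exact ⟨A', B', hB', by linear_combination (p : ℤ) * hAB⟩
      · exact ⟨A, B, hd, rfl⟩
  obtain ⟨x, y, z, h⟩ := hn
  intro hpd
  set d : ℚ := x.den * y.den * z.den * n.den ^ 2 with hd
  have clear : ∀ q : ℚ, q * q.den = q.num := Rat.mul_den_eq_num
  obtain ⟨A', B', hB', hAB⟩ := descent _
    (x.num * y.den * z.den * n.den ^ 2) (y.num * x.den * z.den * n.den ^ 2)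
    (z.num * x.den * y.den * n.den ^ 2) (n.num ^ 2 * x.den * y.den * z.den)
    (x.den * y.den * z.den * n.den ^ 2) rfl (by positivity) (by
      have e : (d * x) ^ 2 - r * (d * y) ^ 2 - M * (d * z) ^ 2 + r * M * (d * n ^ 2) ^ 2 = d ^ 2 := by
        linear_combination d ^ 2 * h
      have e1 : d * x = x.num * y.den * z.den * n.den ^ 2 := by rw [hd, ← clear x]; ring
      have e2 : d * y = y.num * x.den * z.den * n.den ^ 2 := by rw [hd, ← clear y]; ring
      have e3 : d * z = z.num * x.den * y.den * n.den ^ 2 := by rw [hd, ← clear z]; ring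
      have e4 : d * n ^ 2 = n.num ^ 2 * x.den * y.den * z.den := by rw [hd, ← clear n]; ring
      rw [e1, e2, e3, e4, hd] at e
      exact_mod_cast e)
  have hpos : (x.den * y.den * z.den : ℤ) ≠ 0 := by positivity
  have hAB' : n.num ^ 2 * B' = A' * n.den ^ 2 := by
    apply mul_left_cancel₀ hpos
    linear_combination hAB
  have hcop : IsCoprime ((n.den : ℤ) ^ 2) (n.num ^ 2) :=
    (Rat.isCoprime_num_den n).symm.pow
  have hdv : (n.den : ℤ) ^ 2 ∣ B' := hcop.dvd_of_dvd_mul_left ⟨A', by linarith⟩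
  exact hB' ((pow_dvd_pow_of_dvd (by exact_mod_cast hpd) 2).trans hdv)

/-! ### The choice of the nonresidue `r`. -/

theorem exists_common_nonresidue (S : Finset ℕ) (hS : ∀ p ∈ S, p.Prime ∧ p ≠ 2) :
    ∃ c : ℕ, c % 8 = 5 ∧ ∀ p ∈ S, jacobiSym c p = -1 := by
  classical
  induction S using Finset.induction_on with
  | empty => exact ⟨5, rfl, by simp⟩
  | insert p S hpS ih =>
    obtain ⟨c, hc8, hc⟩ := ih fun q hq => hS q (Finset.mem_insert_of_mem hq)
    obtain ⟨hp, hp2⟩ := hS p (Finset.mem_insert_self _ _)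
    have : Fact p.Prime := ⟨hp⟩
    obtain ⟨u, hu⟩ := FiniteField.exists_nonsquare (F := ZMod p) (by rwa [ZMod.ringChar_zmod_n])
    have hcop : (8 * ∏ q ∈ S, q).Coprime p := by
      refine Nat.Coprime.mul_left ?_ (Nat.Coprime.prod_left fun q hq => ?_)
      · exact Nat.Coprime.pow_left 3 ((Nat.coprime_primes Nat.prime_two hp).2 (Ne.symm hp2))
      · refine (Nat.coprime_primes (hS q (Finset.mem_insert_of_mem hq)).1 hp).2 ?_
        rintro rfl
        exact hpS hq
    obtain ⟨c', h1, h2⟩ := Nat.chineseRemainder hcop c u.val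
    refine ⟨c', ?_, ?_⟩
    · have : c' % 8 = c % 8 := Nat.ModEq.of_mul_right _ h1
      omega
    · intro q hq
      rcases Finset.mem_insert.1 hq with rfl | hq
      · refine (ZMod.nonsquare_iff_jacobiSym_eq_neg_one (p := q)).2 ?_
        have : ((c' : ℕ) : ZMod q) = u := by
          rw [(ZMod.natCast_eq_natCast_iff _ _ _).2 h2, ZMod.natCast_zmod_val]
        simpa [this] using hu
      · rw [← hc q hq]
        refine jacobiSym.mod_left' ?_
        have : c' ≡ c [MOD q] := h1.of_dvd ((Finset.dvd_prod_of_mem (fun q => q) hq).trans (dvd_mul_left _ _))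
        exact_mod_cast this

/-- Dirichlet's theorem in the residue class of a common nonresidue. Arbitrarily large prime `r` are
needed so that `r` avoids the primes already committed by a cylinder. -/
theorem exists_prime_nonresidue {M : ℕ} (hM : M ≠ 0) (B : ℕ) :
    ∃ r : ℕ, r.Prime ∧ B < r ∧ r % 8 = 5 ∧
      ∀ p : ℕ, p.Prime → p ∣ M → p ≠ 2 → jacobiSym r p = -1 := by
  classical
  obtain ⟨c, hc8, hc⟩ := exists_common_nonresidue (M.primeFactors.erase 2) fun p hp => by
    rw [Finset.mem_erase] at hp
    exact ⟨Nat.prime_of_mem_primeFactors hp.2, hp.1⟩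
  have hcop : c.Coprime (8 * ∏ p ∈ M.primeFactors.erase 2, p) := by
    refine Nat.Coprime.mul_right ?_ (Nat.Coprime.prod_right fun p hp => ?_)
    · rw [Nat.Coprime, Nat.gcd_comm, Nat.gcd_rec, hc8]; rfl
    · have hp' := Nat.prime_of_mem_primeFactors (Finset.mem_of_mem_erase hp)
      have : NeZero p := ⟨hp'.ne_zero⟩
      have h : jacobiSym c p ≠ 0 := by rw [hc p hp]; decide
      by_contra hne
      exact h (jacobiSym.eq_zero_iff_not_coprime.2 hne)
  obtain ⟨r, hBr, hr, hrc⟩ := Nat.forall_exists_prime_gt_and_modEq B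
    (mul_ne_zero (by norm_num) (Finset.prod_ne_zero_iff.2 fun p hp =>
      (Nat.prime_of_mem_primeFactors (Finset.mem_of_mem_erase hp)).ne_zero)) hcop
  refine ⟨r, hr, hBr, ?_, fun p hp hpM hp2 => ?_⟩
  · have : r % 8 = c % 8 := Nat.ModEq.of_mul_right _ hrc
    omega
  · have hmem : p ∈ M.primeFactors.erase 2 := by simp [hp, hpM, hM, hp2]
    rw [← hc p hmem]
    refine jacobiSym.mod_left' ?_
    have : r ≡ c [MOD p] := hrc.of_dvd ((Finset.dvd_prod_of_mem (fun q => q) hmem).trans (dvd_mul_left _ _))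
    exact_mod_cast this

/-! ### Calculus of formal polynomials. -/

/-- Formal sums of terms, as in `polyOfTerms`. -/
abbrev Terms := List (ℤ × List ℕ)

/-- The value of a formal sum of terms at a rational point. -/
def evalTerms (v : ℕ → ℚ) (t : Terms) : ℚ :=
  (t.map fun m => (m.1 : ℚ) * (m.2.map v).prod).sum

theorem aeval_polyOfTerms (v : ℕ → ℚ) (t : Terms) :
    MvPolynomial.aeval v (polyOfTerms t) = evalTerms v t := by
  rw [polyOfTerms, map_list_sum, List.map_map, evalTerms]
  congr 1
  refine List.map_congr_left fun m _ => ?_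
  simp only [Function.comp_apply, map_mul, map_list_prod, List.map_map, MvPolynomial.aeval_C]
  congr 2
  exact List.map_congr_left fun i _ => by simp

/-- Product of formal sums. -/
def mulTerms (s t : Terms) : Terms :=
  s.flatMap fun m => t.map fun m' => (m.1 * m'.1, m.2 ++ m'.2)

/-- Powers of formal sums. -/
def powTerms (t : Terms) (n : ℕ) : Terms :=
  Nat.rec [(1, [])] (fun _ s => mulTerms t s) n

/-- The constant formal sum. -/
def constTerms (c : ℤ) : Terms := [(c, [])]

/-- The formal sum consisting of a single variable. -/
def varTerms (i : ℕ) : Terms := [(1, [i])]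

section eval
variable (v : ℕ → ℚ)

@[simp] theorem evalTerms_nil : evalTerms v [] = 0 := rfl

@[simp] theorem evalTerms_cons (m : ℤ × List ℕ) (t : Terms) :
    evalTerms v (m :: t) = m.1 * (m.2.map v).prod + evalTerms v t := by
  simp [evalTerms]

@[simp] theorem evalTerms_append (s t : Terms) :
    evalTerms v (s ++ t) = evalTerms v s + evalTerms v t := by
  simp [evalTerms]

@[simp] theorem evalTerms_const (c : ℤ) : evalTerms v (constTerms c) = c := by
  simp [constTerms]

@[simp] theorem evalTerms_var (i : ℕ) : evalTerms v (varTerms i) = v i := by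
  simp [varTerms]

theorem evalTerms_map_mul (m : ℤ × List ℕ) (t : Terms) :
    evalTerms v (t.map fun m' => (m.1 * m'.1, m.2 ++ m'.2)) =
      m.1 * (m.2.map v).prod * evalTerms v t := by
  induction t with
  | nil => simp
  | cons a t ih =>
    rw [List.map_cons, evalTerms_cons, ih, evalTerms_cons]
    simp only [List.map_append, List.prod_append, Int.cast_mul]
    ring

@[simp] theorem evalTerms_mul (s t : Terms) :
    evalTerms v (mulTerms s t) = evalTerms v s * evalTerms v t := by
  induction s with
  | nil => simp [mulTerms]
  | cons a s ih =>
    have : mulTerms (a :: s) t = (t.map fun m' => (a.1 * m'.1, a.2 ++ m'.2)) ++ mulTerms s t := by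
      simp [mulTerms]
    rw [this, evalTerms_append, evalTerms_map_mul, ih, evalTerms_cons]
    ring

@[simp] theorem evalTerms_pow (t : Terms) (n : ℕ) :
    evalTerms v (powTerms t n) = evalTerms v t ^ n := by
  induction n with
  | zero => simp [powTerms]
  | succ n ih =>
    have : powTerms t (n + 1) = mulTerms t (powTerms t n) := rfl
    rw [this, evalTerms_mul, ih, pow_succ']

theorem evalTerms_flatMap {α : Type*} (l : List α) (f : α → Terms) :
    evalTerms v (l.flatMap f) = (l.map fun a => evalTerms v (f a)).sum := by
  induction l with
  | nil => simp
  | cons a l ih => simp [ih]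

theorem evalTerms_flatMap_nonneg {α : Type*} (l : List α) (f : α → Terms)
    (h : ∀ a ∈ l, 0 ≤ evalTerms v (f a)) : 0 ≤ evalTerms v (l.flatMap f) := by
  rw [evalTerms_flatMap]
  exact List.sum_nonneg (by simpa using h)

theorem evalTerms_flatMap_eq_zero {α : Type*} (l : List α) (f : α → Terms)
    (h : ∀ a ∈ l, 0 ≤ evalTerms v (f a)) :
    evalTerms v (l.flatMap f) = 0 ↔ ∀ a ∈ l, evalTerms v (f a) = 0 := by
  induction l with
  | nil => simp
  | cons a l ih =>
    have h' : ∀ b ∈ l, 0 ≤ evalTerms v (f b) := fun b hb => h b (List.mem_cons_of_mem _ hb)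
    rw [List.flatMap_cons, evalTerms_append, add_eq_zero_iff_of_nonneg (h a List.mem_cons_self)
      (evalTerms_flatMap_nonneg v l f h'), ih h', List.forall_mem_cons]

end eval

/-- The list of the variables that occur in a formal sum. -/
def varsTerms (t : Terms) : List ℕ := t.flatMap Prod.snd

theorem evalTerms_congr {v w : ℕ → ℚ} {t : Terms} (h : ∀ i ∈ varsTerms t, v i = w i) :
    evalTerms v t = evalTerms w t := by
  unfold evalTerms
  congr 1
  refine List.map_congr_left fun m hm => ?_
  congr 2
  exact List.map_congr_left fun i hi => h i (List.mem_flatMap.2 ⟨m, hm, hi⟩)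

/-- The product of the `s i` over a list of indices. -/
def prodTerms (s : ℕ → Terms) (l : List ℕ) : Terms :=
  l.foldr (fun i acc => mulTerms (s i) acc) (constTerms 1)

theorem evalTerms_prod (v : ℕ → ℚ) (s : ℕ → Terms) (l : List ℕ) :
    evalTerms v (prodTerms s l) = (l.map fun i => evalTerms v (s i)).prod := by
  induction l with
  | nil => simp [prodTerms]
  | cons a l ih =>
    have : prodTerms s (a :: l) = mulTerms (s a) (prodTerms s l) := rfl
    rw [this, evalTerms_mul, ih]; simp

/-- Substitution of the fractions `s i / y` for the variables, with the denominators cleared by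
a power of `y`. -/
def homTerms (s : ℕ → Terms) (y : Terms) (t : Terms) : Terms :=
  t.flatMap fun m => mulTerms (constTerms m.1)
    (mulTerms (prodTerms s m.2) (powTerms y ((varsTerms t).length - m.2.length)))

theorem evalTerms_hom (v : ℕ → ℚ) (s : ℕ → Terms) (y t : Terms) (hy : evalTerms v y ≠ 0) :
    evalTerms v (homTerms s y t) =
      evalTerms v y ^ (varsTerms t).length *
        evalTerms (fun i => evalTerms v (s i) / evalTerms v y) t := by
  rw [homTerms, evalTerms_flatMap]
  -- The total number of variable occurrences is a crude but computable bound for the degree; any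
  -- such bound serves for clearing denominators.
  generalize hD : (varsTerms t).length = D
  have hlen : ∀ m ∈ t, m.2.length ≤ D := by
    intro m hm
    rw [← hD, varsTerms, List.length_flatMap]
    exact List.single_le_sum (by simp) _ (List.mem_map.2 ⟨m, hm, rfl⟩)
  clear hD
  conv_rhs => rw [evalTerms.eq_1 _ t]
  rw [← List.sum_map_mul_left]
  congr 1
  refine List.map_congr_left fun m hm => ?_
  simp only [evalTerms_mul, evalTerms_const, evalTerms_pow, evalTerms_prod]
  have hp : ∀ l : List ℕ, (l.map fun i => evalTerms v (s i) / evalTerms v y).prod =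
      (l.map fun i => evalTerms v (s i)).prod / evalTerms v y ^ l.length := by
    intro l
    induction l with
    | nil => simp
    | cons a l ih =>
      simp only [List.map_cons, List.prod_cons, ih, List.length_cons, pow_succ']
      rw [div_mul_div_comm]
  rw [hp, pow_sub₀ _ hy (hlen m hm)]
  field_simp

/-! ### Primitive recursiveness -/

section primrec

/-- Nonnegative integers have even codes and negative ones odd codes; integer arithmetic is shown
primitive recursive through this description. -/
theorem encode_int (z : ℤ) :
    Encodable.encode z = if 0 ≤ z then 2 * z.toNat else 2 * (-z).toNat - 1 := by
  cases z with
  | ofNat n => simp; rfl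
  | negSucc n =>
    have h : Encodable.encode (Int.negSucc n) = 2 * n + 1 := rfl
    have h1 : ¬ (0 : ℤ) ≤ Int.negSucc n := by simp
    rw [h, if_neg h1]
    have : (-Int.negSucc n).toNat = n + 1 := rfl
    omega

theorem primrec_int_toNat : Primrec Int.toNat := by
  have : Primrec fun z : ℤ => if Encodable.encode z % 2 = 0 then Encodable.encode z / 2 else 0 :=
    Primrec.ite (Primrec.eq.comp (Primrec.nat_mod.comp Primrec.encode (Primrec.const 2))
      (Primrec.const 0)) (Primrec.nat_div.comp Primrec.encode (Primrec.const 2)) (Primrec.const 0)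
  refine this.of_eq fun z => ?_
  rw [encode_int]
  split_ifs <;> omega

theorem primrec_int_neg_toNat : Primrec fun z : ℤ => (-z).toNat := by
  have : Primrec fun z : ℤ =>
      if Encodable.encode z % 2 = 0 then 0 else Encodable.encode z / 2 + 1 :=
    Primrec.ite (Primrec.eq.comp (Primrec.nat_mod.comp Primrec.encode (Primrec.const 2))
      (Primrec.const 0)) (Primrec.const 0)
      (Primrec.succ.comp (Primrec.nat_div.comp Primrec.encode (Primrec.const 2)))
  refine this.of_eq fun z => ?_
  rw [encode_int]
  split_ifs <;> omega

theorem primrec_int_natSub : Primrec₂ fun a b : ℕ => (a : ℤ) - b := by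
  refine Primrec.encode_iff.1 ?_
  have : Primrec fun p : ℕ × ℕ => if p.2 ≤ p.1 then 2 * (p.1 - p.2) else 2 * (p.2 - p.1) - 1 :=
    Primrec.ite (Primrec.nat_le.comp Primrec.snd Primrec.fst)
      (Primrec.nat_double.comp (Primrec.nat_sub.comp Primrec.fst Primrec.snd))
      (Primrec.nat_sub.comp (Primrec.nat_double.comp (Primrec.nat_sub.comp Primrec.snd Primrec.fst))
        (Primrec.const 1))
  refine this.of_eq fun p => ?_
  rw [encode_int]
  dsimp only
  split_ifs <;> omega

theorem primrec_int_mul : Primrec₂ fun a b : ℤ => a * b := by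
  have p1 : Primrec fun p : ℤ × ℤ => p.1.toNat := primrec_int_toNat.comp Primrec.fst
  have p2 : Primrec fun p : ℤ × ℤ => p.2.toNat := primrec_int_toNat.comp Primrec.snd
  have n1 : Primrec fun p : ℤ × ℤ => (-p.1).toNat := primrec_int_neg_toNat.comp Primrec.fst
  have n2 : Primrec fun p : ℤ × ℤ => (-p.2).toNat := primrec_int_neg_toNat.comp Primrec.snd
  have := primrec_int_natSub.comp
    (Primrec.nat_add.comp (Primrec.nat_mul.comp p1 p2) (Primrec.nat_mul.comp n1 n2))
    (Primrec.nat_add.comp (Primrec.nat_mul.comp p1 n2) (Primrec.nat_mul.comp n1 p2))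
  refine this.of_eq fun p => ?_
  have e : ∀ z : ℤ, z = z.toNat - (-z).toNat := by intro z; omega
  conv_rhs => rw [e p.1, e p.2]
  push_cast
  ring

theorem primrec_int_ofNat : Primrec fun n : ℕ => (n : ℤ) :=
  (primrec_int_natSub.comp Primrec.id (Primrec.const 0)).of_eq fun n => by simp

theorem primrec_mulTerms : Primrec₂ mulTerms := by
  unfold mulTerms
  refine Primrec.list_flatMap Primrec.fst ?_
  refine Primrec.list_map (Primrec.snd.comp Primrec.fst) ?_
  refine Primrec.pair ?_ ?_
  · exact primrec_int_mul.comp (Primrec.fst.comp (Primrec.snd.comp Primrec.fst))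
      (Primrec.fst.comp Primrec.snd)
  · exact Primrec.list_append.comp (Primrec.snd.comp (Primrec.snd.comp Primrec.fst))
      (Primrec.snd.comp Primrec.snd)

theorem primrec_powTerms : Primrec₂ powTerms := by
  unfold powTerms
  exact Primrec.nat_rec (f := fun _ => [(1, [])]) (g := fun t p => mulTerms t p.2)
    (Primrec.const _) (primrec_mulTerms.comp Primrec.fst (Primrec.snd.comp Primrec.snd))

theorem primrec_constTerms : Primrec constTerms :=
  Primrec.list_cons.comp (Primrec.pair Primrec.id (Primrec.const [])) (Primrec.const [])

theorem primrec_varTerms : Primrec varTerms :=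
  Primrec.list_cons.comp (Primrec.pair (Primrec.const 1)
    (Primrec.list_cons.comp Primrec.id (Primrec.const []))) (Primrec.const [])

theorem primrec_varsTerms : Primrec varsTerms :=
  Primrec.list_flatMap Primrec.id (Primrec.snd.comp Primrec.snd)

theorem primrec_homTerms {α : Type*} [Primcodable α] {s : α → ℕ → Terms} {y t : α → Terms}
    (hs : Primrec₂ s) (hy : Primrec y) (ht : Primrec t) :
    Primrec fun a => homTerms (s a) (y a) (t a) := by
  unfold homTerms
  refine Primrec.list_flatMap ht ?_
  refine primrec_mulTerms.comp (primrec_constTerms.comp (Primrec.fst.comp Primrec.snd))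
    (primrec_mulTerms.comp ?_ ?_)
  · exact Primrec.list_foldr (f := fun p : α × (ℤ × List ℕ) => p.2.2)
      (g := fun _ => constTerms 1) (h := fun p q => mulTerms (s p.1 q.1) q.2)
      (Primrec.snd.comp Primrec.snd) (Primrec.const _)
      (primrec_mulTerms.comp
        (hs.comp (Primrec.fst.comp Primrec.fst) (Primrec.fst.comp Primrec.snd))
        (Primrec.snd.comp Primrec.snd))
  · exact primrec_powTerms.comp (hy.comp Primrec.fst) (Primrec.nat_sub.comp
      (Primrec.list_length.comp (primrec_varsTerms.comp (ht.comp Primrec.fst)))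
      (Primrec.list_length.comp (Primrec.snd.comp Primrec.snd)))

end primrec

/-! ### Solvability in sets of rationals and common denominators. -/

/-- Solvability of `t = 0` in a set of rationals. -/
def SolvableIn (D : Set ℚ) (t : Terms) : Prop :=
  ∃ v : ℕ → ℚ, (∀ i, v i ∈ D) ∧ evalTerms v t = 0

theorem SolvableIn.mono {D E : Set ℚ} (h : D ⊆ E) {t : Terms} (ht : SolvableIn D t) :
    SolvableIn E t :=
  ht.imp fun _ hv => ⟨fun i => h (hv.1 i), hv.2⟩

/-- Only the variables that occur matter for solvability. -/
theorem solvableIn_of_vars {D : Set ℚ} (h0 : (0 : ℚ) ∈ D) {t : Terms} {v : ℕ → ℚ}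
    (hv : ∀ i ∈ varsTerms t, v i ∈ D) (h : evalTerms v t = 0) : SolvableIn D t := by
  classical
  refine ⟨fun i => if i ∈ varsTerms t then v i else 0, fun i => ?_, ?_⟩
  · dsimp only
    split_ifs with hi
    · exact hv i hi
    · exact h0
  · rw [← h]
    exact evalTerms_congr fun i hi => if_pos hi

/-- The product of the denominators. The last clause is what keeps this denominator invertible in
any `R_W` containing the values. -/
theorem exists_common_den (v : ℕ → ℚ) (l : List ℕ) :
    ∃ d : ℕ, 0 < d ∧ (∀ i ∈ l, ∃ k : ℤ, v i * d = k) ∧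
      ∀ p : ℕ, p.Prime → p ∣ d → ∃ i ∈ l, p ∣ (v i).den := by
  induction l with
  | nil => exact ⟨1, one_pos, by simp, fun p hp h => absurd (Nat.dvd_one.1 h) hp.ne_one⟩
  | cons a l ih =>
    obtain ⟨d, hd, h1, h2⟩ := ih
    refine ⟨(v a).den * d, Nat.mul_pos (v a).den_pos hd, ?_, ?_⟩
    · intro i hi
      rcases List.mem_cons.1 hi with rfl | hi
      · exact ⟨(v i).num * d, by
          push_cast; rw [← mul_assoc, Rat.mul_den_eq_num]⟩
      · obtain ⟨k, hk⟩ := h1 i hi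
        exact ⟨k * (v a).den, by push_cast; rw [← hk]; ring⟩
    · intro p hp hpd
      rcases hp.dvd_mul.1 hpd with h | h
      · exact ⟨a, List.mem_cons_self, h⟩
      · obtain ⟨i, hi, h⟩ := h2 p hp h
        exact ⟨i, List.mem_cons_of_mem _ hi, h⟩

/-! ### Reduction of solvability in `ℚ` to solvability in a subring -/

/-- The polynomial `1 + X₀² + X₁² + X₂² + X₃²`. -/
def fourSqTerms : Terms := [(1, []), (1, [0, 0]), (1, [1, 1]), (1, [2, 2]), (1, [3, 3])]

/-- The polynomial `t` with `X_i` replaced by the fraction `X_{i+4} / (1 + X₀² + ⋯ + X₃²)` and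
denominators cleared. -/
def projTerms (t : Terms) : Terms := homTerms (fun i => varTerms (i + 4)) fourSqTerms t

theorem evalTerms_fourSq (v : ℕ → ℚ) :
    evalTerms v fourSqTerms = 1 + v 0 ^ 2 + v 1 ^ 2 + v 2 ^ 2 + v 3 ^ 2 := by
  simp [fourSqTerms]; ring

theorem solvableIn_projTerms {D : Set ℚ} (hD : ∀ k : ℤ, (k : ℚ) ∈ D) (t : Terms) :
    SolvableIn D (projTerms t) ↔ SolvableIn Set.univ t := by
  constructor
  · rintro ⟨v, -, hv⟩
    have hY : evalTerms v fourSqTerms ≠ 0 := by rw [evalTerms_fourSq]; positivity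
    rw [projTerms, evalTerms_hom _ _ _ _ hY] at hv
    exact ⟨_, fun _ => Set.mem_univ _, (mul_eq_zero.1 hv).resolve_left (pow_ne_zero _ hY)⟩
  · rintro ⟨v, -, hv⟩
    obtain ⟨d, hd, hint, -⟩ := exists_common_den v (varsTerms t)
    choose! k hk using hint
    -- Lagrange for `d - 1`, since the substituted denominator carries the summand `1` that keeps it
    -- nonzero.
    obtain ⟨a, b, c, e, habc⟩ := Nat.sum_four_squares (d - 1)
    let w : ℕ → ℤ := fun i =>
      if i = 0 then a else if i = 1 then b else if i = 2 then c else if i = 3 then e else k (i - 4)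
    have hY : evalTerms (fun i => (w i : ℚ)) fourSqTerms = d := by
      rw [evalTerms_fourSq]
      have h : 1 + a ^ 2 + b ^ 2 + c ^ 2 + e ^ 2 = d := by omega
      have h0 : w 0 = a := rfl
      have h1 : w 1 = b := rfl
      have h2 : w 2 = c := rfl
      have h3 : w 3 = e := rfl
      rw [h0, h1, h2, h3]
      exact_mod_cast h
    have hd' : (d : ℚ) ≠ 0 := by exact_mod_cast hd.ne'
    refine ⟨fun i => w i, fun i => hD _, ?_⟩
    rw [projTerms, evalTerms_hom _ _ _ _ (by rwa [hY]), hY]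
    have : evalTerms (fun i => evalTerms (fun i => (w i : ℚ)) (varTerms (i + 4)) / d) t =
        evalTerms v t := by
      refine evalTerms_congr fun i hi => ?_
      have hw : w (i + 4) = k i := by simp [w]
      rw [evalTerms_var, hw, ← hk i hi]
      field_simp
    rw [this, hv, mul_zero]

theorem primrec_projTerms : Primrec projTerms :=
  primrec_homTerms (s := fun (_ : Terms) i => varTerms (i + 4)) (y := fun _ => fourSqTerms)
    (primrec_varTerms.comp (Primrec.nat_add.comp Primrec.snd (Primrec.const 4)))
    (Primrec.const _) Primrec.id

/-! ### Solvability in `localSet r M` -/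

/-- The square of a formal sum. -/
def sqTerms (t : Terms) : Terms := mulTerms t t

@[simp] theorem evalTerms_sq (v : ℕ → ℚ) (t : Terms) :
    evalTerms v (sqTerms t) = evalTerms v t ^ 2 := by rw [sqTerms, evalTerms_mul, sq]

/-- The equation expressing that `X_{4i}` belongs to `localSet r M`, with auxiliary variables
`X_{4i+1}`, `X_{4i+2}`, `X_{4i+3}`. -/
def localTerms (r M i : ℕ) : Terms :=
  [(1, [4 * i + 1, 4 * i + 1]), (-1 * r, [4 * i + 2, 4 * i + 2]), (-1 * M, [4 * i + 3, 4 * i + 3]),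
    (r * M, [4 * i, 4 * i, 4 * i, 4 * i]), (-1, [])]

theorem evalTerms_local (v : ℕ → ℚ) (r M i : ℕ) :
    evalTerms v (localTerms r M i) = v (4 * i + 1) ^ 2 - r * v (4 * i + 2) ^ 2
      - M * v (4 * i + 3) ^ 2 + r * M * v (4 * i) ^ 4 - 1 := by
  simp [localTerms]; ring

/-- Renaming of `X_i` to `X_{4i}`. -/
def renTerms (t : Terms) : Terms := t.map fun m => (m.1, m.2.map (4 * ·))

theorem evalTerms_ren (v : ℕ → ℚ) (t : Terms) :
    evalTerms v (renTerms t) = evalTerms (fun i => v (4 * i)) t := by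
  simp only [evalTerms, renTerms, List.map_map, Function.comp_def]

/-- A polynomial which has a rational zero if and only if `t` has a zero in `localSet r M`. -/
def locTerms (r M : ℕ) (t : Terms) : Terms :=
  sqTerms (renTerms t) ++ (varsTerms t).flatMap fun i => sqTerms (localTerms r M i)

/-- Over `ℚ` a sum of squares vanishes only if each summand does, so the conditions on the variables
that occur merge with `t` into one equation. The other variables can be set to `0`, which lies in
`localSet r M`. -/
theorem solvableIn_locTerms (r M : ℕ) (t : Terms) :
    SolvableIn Set.univ (locTerms r M t) ↔ SolvableIn (localSet r M) t := by
  have key : ∀ v : ℕ → ℚ, evalTerms v (locTerms r M t) = 0 ↔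
      evalTerms (fun i => v (4 * i)) t = 0 ∧
        ∀ i ∈ varsTerms t, evalTerms v (localTerms r M i) = 0 := by
    intro v
    have hn : ∀ i ∈ varsTerms t, 0 ≤ evalTerms v (sqTerms (localTerms r M i)) := by
      intro i _; rw [evalTerms_sq]; positivity
    rw [locTerms, evalTerms_append, add_eq_zero_iff_of_nonneg
      (by rw [evalTerms_sq]; positivity) (evalTerms_flatMap_nonneg _ _ _ hn),
      evalTerms_flatMap_eq_zero _ _ _ hn]
    simp [evalTerms_ren]
  constructor
  · rintro ⟨v, -, hv⟩
    obtain ⟨h1, h2⟩ := (key v).1 hv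
    refine solvableIn_of_vars (zero_mem_localSet r M) (fun i hi => ?_) h1
    refine ⟨v (4 * i + 1), v (4 * i + 2), v (4 * i + 3), ?_⟩
    have := h2 i hi
    rw [evalTerms_local] at this
    linarith
  · rintro ⟨v, hv, h⟩
    choose x y z hxyz using hv
    let w : ℕ → ℚ := fun j => if j % 4 = 0 then v (j / 4) else if j % 4 = 1 then x (j / 4)
      else if j % 4 = 2 then y (j / 4) else z (j / 4)
    have w0 : ∀ i, w (4 * i) = v i := fun i => by
      have h1 : 4 * i % 4 = 0 := by omega
      have h2 : 4 * i / 4 = i := by omega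
      simp only [w, h1, h2, if_true]
    have w1 : ∀ i, w (4 * i + 1) = x i := fun i => by
      have h1 : (4 * i + 1) % 4 = 1 := by omega
      have h2 : (4 * i + 1) / 4 = i := by omega
      simp [w, h1, h2]
    have w2 : ∀ i, w (4 * i + 2) = y i := fun i => by
      have h1 : (4 * i + 2) % 4 = 2 := by omega
      have h2 : (4 * i + 2) / 4 = i := by omega
      simp [w, h1, h2]
    have w3 : ∀ i, w (4 * i + 3) = z i := fun i => by
      have h1 : (4 * i + 3) % 4 = 3 := by omega
      have h2 : (4 * i + 3) / 4 = i := by omega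
      simp [w, h1, h2]
    refine ⟨w, fun _ => Set.mem_univ _, (key w).2 ⟨?_, fun i _ => ?_⟩⟩
    · simpa only [w0] using h
    · rw [evalTerms_local, w0, w1, w2, w3]
      linarith [hxyz i]

theorem primrec_sqTerms : Primrec sqTerms := primrec_mulTerms.comp Primrec.id Primrec.id

theorem primrec_localTerms {α : Type*} [Primcodable α] {r M i : α → ℕ} (hr : Primrec r)
    (hM : Primrec M) (hi : Primrec i) : Primrec fun a => localTerms (r a) (M a) (i a) := by
  have h4 : Primrec fun a => 4 * i a := Primrec.nat_mul.comp (Primrec.const 4) hi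
  have hk : ∀ k : ℕ, Primrec fun a => 4 * i a + k := fun k =>
    Primrec.nat_add.comp h4 (Primrec.const k)
  have hrz : Primrec fun a => (r a : ℤ) := primrec_int_ofNat.comp hr
  have hMz : Primrec fun a => (M a : ℤ) := primrec_int_ofNat.comp hM
  have cons : ∀ {β : Type} [Primcodable β] {f : α → β} {g : α → List β}, Primrec f → Primrec g →
      Primrec fun a => f a :: g a := fun hf hg => Primrec.list_cons.comp hf hg
  unfold localTerms
  refine cons (Primrec.pair (Primrec.const _) (cons (hk 1) (cons (hk 1) (Primrec.const _)))) ?_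
  refine cons (Primrec.pair (primrec_int_mul.comp (Primrec.const _) hrz)
    (cons (hk 2) (cons (hk 2) (Primrec.const _)))) ?_
  refine cons (Primrec.pair (primrec_int_mul.comp (Primrec.const _) hMz)
    (cons (hk 3) (cons (hk 3) (Primrec.const _)))) ?_
  refine cons (Primrec.pair (primrec_int_mul.comp hrz hMz)
    (cons h4 (cons h4 (cons h4 (cons h4 (Primrec.const _)))))) ?_
  exact Primrec.const _

theorem primrec_renTerms : Primrec renTerms := by
  unfold renTerms
  refine Primrec.list_map Primrec.id (Primrec.pair (Primrec.fst.comp Primrec.snd) ?_)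
  exact Primrec.list_map (Primrec.snd.comp Primrec.snd)
    (Primrec.nat_mul.comp (Primrec.const 4) Primrec.snd)

theorem primrec_locTerms {α : Type*} [Primcodable α] {r M : α → ℕ} {t : α → Terms}
    (hr : Primrec r) (hM : Primrec M) (ht : Primrec t) :
    Primrec fun a => locTerms (r a) (M a) (t a) := by
  unfold locTerms
  refine Primrec.list_append.comp (primrec_sqTerms.comp (primrec_renTerms.comp ht)) ?_
  refine Primrec.list_flatMap (primrec_varsTerms.comp ht) ?_
  exact primrec_sqTerms.comp (primrec_localTerms (hr.comp Primrec.fst) (hM.comp Primrec.fst)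
    Primrec.snd)

/-! ### A single query for a list of certificates -/

/-- A certificate for the (un)solvability of a polynomial: `inl (r, M)` claims that there is no
zero in `localSet r M`, and `inr x` gives the numerators of a zero. -/
abbrev Cert := (ℕ × ℕ) ⊕ List ℤ

/-- The value of `t` at the fractions `x i / N`, with denominators cleared. -/
def valueTerms (N : ℕ) (x : List ℤ) (t : Terms) : Terms :=
  homTerms (fun i => constTerms (x.getD i 0)) (constTerms N) t

theorem evalTerms_value (v : ℕ → ℚ) {N : ℕ} (hN : N ≠ 0) (x : List ℤ) (t : Terms) :
    evalTerms v (valueTerms N x t) = (N : ℚ) ^ (varsTerms t).length *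
      evalTerms (fun i => (x.getD i 0 : ℚ) / N) t := by
  have hN' : ((N : ℤ) : ℚ) ≠ 0 := by exact_mod_cast hN
  rw [valueTerms, evalTerms_hom _ _ _ _ (by rwa [evalTerms_const])]
  simp

/-- The factor of the query contributed by a negative certificate. -/
def negPart (p : Terms × Cert) : Terms :=
  Sum.casesOn p.2 (fun c => locTerms c.1 c.2 p.1) fun _ => constTerms 1

/-- The summand of the query contributed by a positive certificate. -/
def posPart (N : ℕ) (p : Terms × Cert) : Terms :=
  Sum.casesOn p.2 (fun _ => []) fun x => sqTerms (valueTerms N x p.1)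

/-- A polynomial without rational zeros if and only if all certificates are correct. -/
def queryTerms (N : ℕ) (Z : List (Terms × Cert)) : Terms :=
  mulTerms (Z.foldr (fun p acc => mulTerms (negPart p) acc) (constTerms 1))
    (mulTerms (Z.flatMap (posPart N)) (varTerms 0) ++ constTerms (-1))

/-- Correctness of a certificate for `t`. -/
def CertHolds (N : ℕ) (p : Terms × Cert) : Prop :=
  (∀ r M, p.2 = Sum.inl (r, M) → ¬ SolvableIn (localSet r M) p.1) ∧
    ∀ x : List ℤ, p.2 = Sum.inr x → evalTerms (fun i => (x.getD i 0 : ℚ) / N) p.1 = 0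

/-- The query is a product, so it is unsolvable iff every factor is. The negative certificates are
factors. The positive ones enter through a constant `P`, a sum of squares that vanishes iff all of
them hold, and the factor `P X₀ - 1`, which has a rational zero iff `P ≠ 0`. -/
theorem not_solvableIn_queryTerms {N : ℕ} (hN : N ≠ 0) (Z : List (Terms × Cert)) :
    ¬ SolvableIn Set.univ (queryTerms N Z) ↔ ∀ p ∈ Z, CertHolds N p := by
  have hneg : ∀ v : ℕ → ℚ, evalTerms v
      (Z.foldr (fun p acc => mulTerms (negPart p) acc) (constTerms 1)) = 0 ↔
      ∃ p ∈ Z, evalTerms v (negPart p) = 0 := by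
    intro v
    induction Z with
    | nil => simp
    | cons a Z ih => simp [ih]
  have hval : ∀ v : ℕ → ℚ, ∀ t x, evalTerms v (posPart N (t, Sum.inr x)) =
      ((N : ℚ) ^ (varsTerms t).length * evalTerms (fun i => (x.getD i 0 : ℚ) / N) t) ^ 2 := by
    intro v t x
    change evalTerms v (sqTerms (valueTerms N x t)) = _
    rw [evalTerms_sq, evalTerms_value _ hN]
  have hposn : ∀ v : ℕ → ℚ, ∀ p ∈ Z, 0 ≤ evalTerms v (posPart N p) := by
    rintro v ⟨t, c | x⟩ -
    · exact le_rfl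
    · rw [hval]; positivity
  obtain ⟨P, hP⟩ : ∃ P : ℚ, ∀ v, evalTerms v (Z.flatMap (posPart N)) = P := by
    refine ⟨evalTerms 0 (Z.flatMap (posPart N)), fun v => ?_⟩
    rw [evalTerms_flatMap, evalTerms_flatMap]
    congr 1
    refine List.map_congr_left ?_
    rintro ⟨t, c | x⟩ -
    · rfl
    · rw [hval, hval]
  have hP0 : P = 0 ↔ ∀ p ∈ Z, ∀ x : List ℤ, p.2 = Sum.inr x →
      evalTerms (fun i => (x.getD i 0 : ℚ) / N) p.1 = 0 := by
    rw [← hP 0, evalTerms_flatMap_eq_zero _ _ _ (hposn 0)]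
    refine forall₂_congr ?_
    rintro ⟨t, c | x⟩ -
    · exact ⟨fun _ _ hx => (nomatch hx), fun _ => rfl⟩
    · rw [hval]
      have : (N : ℚ) ^ (varsTerms t).length ≠ 0 := pow_ne_zero _ (by exact_mod_cast hN)
      rw [sq_eq_zero_iff, mul_eq_zero, or_iff_right this]
      exact ⟨fun h y hy => by cases hy; exact h, fun h => h x rfl⟩
  have hev : ∀ v, evalTerms v (queryTerms N Z) = 0 ↔
      (∃ p ∈ Z, evalTerms v (negPart p) = 0) ∨ P * v 0 = 1 := by
    intro v
    rw [queryTerms, evalTerms_mul, mul_eq_zero, hneg, evalTerms_append, evalTerms_mul, hP]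
    simp [add_neg_eq_zero]
  constructor
  · intro h
    have hP' : P = 0 := by
      by_contra hne
      exact h ⟨fun _ => P⁻¹, fun _ => Set.mem_univ _, (hev _).2 (Or.inr (mul_inv_cancel₀ hne))⟩
    refine fun p hp => ⟨fun r M hrM hs => ?_, hP0.1 hP' p hp⟩
    obtain ⟨v, hv, h0⟩ := (solvableIn_locTerms r M p.1).2 hs
    refine h ⟨v, hv, (hev _).2 (Or.inl ⟨p, hp, ?_⟩)⟩
    rw [negPart, hrM]
    exact h0
  · rintro h ⟨v, hv, h0⟩
    rcases (hev v).1 h0 with ⟨⟨t, ⟨r, M⟩ | x⟩, hp, hz⟩ | hz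
    · exact (h _ hp).1 r M rfl ((solvableIn_locTerms r M t).1 ⟨v, hv, hz⟩)
    · have : evalTerms v (constTerms 1) = 0 := hz
      simp at this
    · rw [hP0.2 fun p hp => (h p hp).2] at hz
      simp at hz

theorem primrec_valueTerms {α : Type*} [Primcodable α] {N : α → ℕ} {x : α → List ℤ}
    {t : α → Terms} (hN : Primrec N) (hx : Primrec x) (ht : Primrec t) :
    Primrec fun a => valueTerms (N a) (x a) (t a) :=
  primrec_homTerms (s := fun a i => constTerms ((x a).getD i 0))
    (y := fun a => constTerms (N a))
    (primrec_constTerms.comp ((Primrec.list_getD 0).comp (hx.comp Primrec.fst) Primrec.snd))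
    (primrec_constTerms.comp (primrec_int_ofNat.comp hN)) ht

theorem primrec_negPart : Primrec negPart :=
  Primrec.sumCasesOn (f := fun p : Terms × Cert => p.2)
    (g := fun p c => locTerms c.1 c.2 p.1) (h := fun _ _ => constTerms 1) Primrec.snd
    (primrec_locTerms (Primrec.fst.comp Primrec.snd) (Primrec.snd.comp Primrec.snd)
      (Primrec.fst.comp Primrec.fst)) (Primrec.const _)

theorem primrec_posPart : Primrec₂ posPart :=
  Primrec.sumCasesOn (f := fun q : ℕ × Terms × Cert => q.2.2)
    (g := fun _ _ => []) (h := fun q x => sqTerms (valueTerms q.1 x q.2.1))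
    (Primrec.snd.comp Primrec.snd) (Primrec.const _)
    (primrec_sqTerms.comp (primrec_valueTerms (Primrec.fst.comp Primrec.fst) Primrec.snd
      (Primrec.fst.comp (Primrec.snd.comp Primrec.fst))))

theorem primrec_queryTerms : Primrec₂ queryTerms := by
  unfold queryTerms
  refine primrec_mulTerms.comp ?_ (Primrec.list_append.comp (primrec_mulTerms.comp ?_
    (Primrec.const _)) (Primrec.const _))
  · exact Primrec.list_foldr (f := fun q : ℕ × List (Terms × Cert) => q.2)
      (g := fun _ => constTerms 1) (h := fun _ q => mulTerms (negPart q.1) q.2)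
      Primrec.snd (Primrec.const _)
      (primrec_mulTerms.comp (primrec_negPart.comp (Primrec.fst.comp Primrec.snd))
        (Primrec.snd.comp Primrec.snd))
  · exact Primrec.list_flatMap Primrec.snd
      (primrec_posPart.comp (Primrec.fst.comp Primrec.fst) Primrec.snd)

/-! ### Oracle computations through initial segments. -/

open Classical in
/-- The initial segment of length `k` of the characteristic function of `B`. -/
noncomputable def initialSegment (B : Set ℕ) (k : ℕ) : List ℕ :=
  (List.range k).map fun i => if i ∈ B then 1 else 0

/-- `φ`, applied to longer and longer initial segments of the oracle `B`, converges to `f`. -/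
structure Approximates (φ : List ℕ → ℕ →. ℕ) (B : Set ℕ) (f : ℕ →. ℕ) : Prop where
  mono : ∀ {j k n m}, j ≤ k → m ∈ φ (initialSegment B j) n → m ∈ φ (initialSegment B k) n
  mem_iff : ∀ {n m}, m ∈ f n ↔ ∃ k, m ∈ φ (initialSegment B k) n

theorem Approximates.of_const (B : Set ℕ) (f : ℕ →. ℕ) : Approximates (fun _ => f) B f :=
  ⟨fun _ h => h, by simp⟩

theorem mem_rfind_eq_zero {g : ℕ → Part ℕ} {m : ℕ} :
    m ∈ Nat.rfind (fun n => (g n).map fun m => decide (m = 0)) ↔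
      0 ∈ g m ∧ ∀ i < m, ∃ c ∈ g i, c ≠ 0 := by
  refine Nat.mem_rfind.trans (and_congr ?_ ?_)
  · simp [Part.mem_map_iff]
  · simp [Part.mem_map_iff]

/-- A function recursive in `B` is approximated by a partial recursive function of the initial
segments of `B`. -/
theorem exists_approximates {B : Set ℕ} {f : ℕ →. ℕ} (hf : Nat.RecursiveIn {charFn B} f) :
    ∃ φ : List ℕ → ℕ →. ℕ, Partrec₂ φ ∧ Approximates φ B f := by
  have of_partrec : ∀ {g : ℕ →. ℕ}, Nat.Partrec g →
      ∃ φ : List ℕ → ℕ →. ℕ, Partrec₂ φ ∧ Approximates φ B g := fun {g} hg =>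
    ⟨fun _ => g, (Partrec.nat_iff.2 hg).comp Computable.snd, Approximates.of_const B g⟩
  induction hf with
  | zero => exact of_partrec .zero
  | succ => exact of_partrec .succ
  | left => exact of_partrec .left
  | right => exact of_partrec .right
  | oracle g hg =>
    obtain rfl : g = charFn B := hg
    have hmem : ∀ {k n m}, m ∈ (((initialSegment B k)[n]? : Option ℕ) : Part ℕ) ↔
        n < k ∧ m ∈ charFn B n := by
      intro k n m
      by_cases hn : n < k
      · simp only [initialSegment, List.getElem?_map, List.getElem?_range hn, hn, true_and]
        simp [charFn]
      · simp [initialSegment, hn]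
    refine ⟨fun L n => (L[n]? : Option ℕ), Computable.ofOption Computable.list_getElem?, ?_, ?_⟩
    · intro j k n m hjk h
      rw [hmem] at h ⊢
      exact ⟨h.1.trans_le hjk, h.2⟩
    · intro n m
      simp only [hmem]
      exact ⟨fun h => ⟨n + 1, n.lt_succ_self, h⟩, fun ⟨_, _, h⟩ => h⟩
  | @pair f h _ _ ihf ihh =>
    obtain ⟨φ, hφ, aφ⟩ := ihf
    obtain ⟨ψ, hψ, aψ⟩ := ihh
    refine ⟨fun L n => (φ L n).bind fun a => (ψ L n).map (Nat.pair a), ?_, ?_, ?_⟩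
    · refine Partrec.bind hφ (Partrec.map (hψ.comp (Computable.fst.comp Computable.fst)
        (Computable.snd.comp Computable.fst)) ?_)
      exact (Primrec₂.natPair.comp (Primrec.snd.comp Primrec.fst) Primrec.snd).to_comp
    · intro j k n m hjk
      simp only [Part.mem_bind_iff, Part.mem_map_iff]
      rintro ⟨a, ha, b, hb, rfl⟩
      exact ⟨a, aφ.mono hjk ha, b, aψ.mono hjk hb, rfl⟩
    · intro n m
      have : (Nat.pair <$> f n <*> h n) = (f n).bind fun a => (h n).map (Nat.pair a) := by
        simp [Seq.seq, Part.bind_map]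
      rw [this]
      simp only [Part.mem_bind_iff, Part.mem_map_iff]
      constructor
      · rintro ⟨a, ha, b, hb, rfl⟩
        obtain ⟨j, hj⟩ := aφ.mem_iff.1 ha
        obtain ⟨k, hk⟩ := aψ.mem_iff.1 hb
        exact ⟨max j k, a, aφ.mono (le_max_left _ _) hj, b, aψ.mono (le_max_right _ _) hk, rfl⟩
      · rintro ⟨k, a, ha, b, hb, rfl⟩
        exact ⟨a, aφ.mem_iff.2 ⟨k, ha⟩, b, aψ.mem_iff.2 ⟨k, hb⟩, rfl⟩
  | @comp f h _ _ ihf ihh =>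
    obtain ⟨φ, hφ, aφ⟩ := ihf
    obtain ⟨ψ, hψ, aψ⟩ := ihh
    refine ⟨fun L n => (ψ L n).bind (φ L), ?_, ?_, ?_⟩
    · exact Partrec.bind hψ (hφ.comp (Computable.fst.comp Computable.fst) Computable.snd)
    · intro j k n m hjk hm
      obtain ⟨a, ha, hm⟩ := Part.mem_bind_iff.1 hm
      exact Part.mem_bind_iff.2 ⟨a, aψ.mono hjk ha, aφ.mono hjk hm⟩
    · intro n m
      constructor
      · intro hm
        obtain ⟨a, ha, hm⟩ := Part.mem_bind_iff.1 hm
        obtain ⟨j, hj⟩ := aψ.mem_iff.1 ha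
        obtain ⟨k, hk⟩ := aφ.mem_iff.1 hm
        exact ⟨max j k, Part.mem_bind_iff.2
          ⟨a, aψ.mono (le_max_left _ _) hj, aφ.mono (le_max_right _ _) hk⟩⟩
      · rintro ⟨k, hm⟩
        obtain ⟨a, ha, hm⟩ := Part.mem_bind_iff.1 hm
        exact Part.mem_bind_iff.2 ⟨a, aψ.mem_iff.2 ⟨k, ha⟩, aφ.mem_iff.2 ⟨k, hm⟩⟩
  | @prec f h _ _ ihf ihh =>
    obtain ⟨φ, hφ, aφ⟩ := ihf
    obtain ⟨ψ, hψ, aψ⟩ := ihh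
    let R : List ℕ → ℕ → ℕ → Part ℕ := fun L a n =>
      Nat.rec (φ L a) (fun y IH => IH.bind fun i => ψ L (Nat.pair a (Nat.pair y i))) n
    have hR : ∀ L a y m, m ∈ R L a (y + 1) ↔
        ∃ i ∈ R L a y, m ∈ ψ L (Nat.pair a (Nat.pair y i)) := fun L a y m => Part.mem_bind_iff
    have Rmono : ∀ {j k a} n {m}, j ≤ k → m ∈ R (initialSegment B j) a n →
        m ∈ R (initialSegment B k) a n := by
      intro j k a n
      induction n with
      | zero => exact fun hjk hm => aφ.mono hjk hm
      | succ n ih =>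
        intro m hjk hm
        obtain ⟨i, hi, hm⟩ := (hR _ _ _ _).1 hm
        exact (hR _ _ _ _).2 ⟨i, ih hjk hi, aψ.mono hjk hm⟩
    refine ⟨fun L p => R L p.unpair.1 p.unpair.2, ?_, ?_, ?_⟩
    · refine Partrec.nat_rec (f := fun q : List ℕ × ℕ => q.2.unpair.2)
        (g := fun q => φ q.1 q.2.unpair.1)
        (h := fun q r => ψ q.1 (Nat.pair q.2.unpair.1 (Nat.pair r.1 r.2))) ?_ ?_ ?_
      · exact Computable.snd.comp (Computable.unpair.comp Computable.snd)
      · exact hφ.comp Computable.fst (Computable.fst.comp (Computable.unpair.comp Computable.snd))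
      · refine hψ.comp (Computable.fst.comp Computable.fst) ?_
        exact (Primrec₂.natPair.comp
          (Primrec.fst.comp (Primrec.unpair.comp (Primrec.snd.comp Primrec.fst)))
          (Primrec₂.natPair.comp (Primrec.fst.comp Primrec.snd)
            (Primrec.snd.comp Primrec.snd))).to_comp
    · intro j k n m hjk hm
      exact Rmono _ hjk hm
    · intro p m
      change m ∈ Nat.rec (motive := fun _ => Part ℕ) (f p.unpair.1)
        (fun y IH => IH.bind fun i => h (Nat.pair p.unpair.1 (Nat.pair y i))) p.unpair.2 ↔ _
      generalize p.unpair.1 = a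
      generalize p.unpair.2 = n
      induction n generalizing m with
      | zero => exact aφ.mem_iff
      | succ n ih =>
        refine Part.mem_bind_iff.trans ?_
        simp only [hR]
        constructor
        · rintro ⟨i, hi, hm⟩
          obtain ⟨j, hj⟩ := ih.1 hi
          obtain ⟨k, hk⟩ := aψ.mem_iff.1 hm
          exact ⟨max j k, i, Rmono _ (le_max_left _ _) hj, aψ.mono (le_max_right _ _) hk⟩
        · rintro ⟨k, i, hi, hm⟩
          exact ⟨i, ih.2 ⟨k, hi⟩, aψ.mem_iff.2 ⟨k, hm⟩⟩
  | @rfind f _ ihf =>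
    obtain ⟨φ, hφ, aφ⟩ := ihf
    refine ⟨fun L a => Nat.rfind fun n => (φ L (Nat.pair a n)).map fun m => decide (m = 0), ?_, ?_, ?_⟩
    · refine Partrec.rfind (p := fun (q : List ℕ × ℕ) n =>
        (φ q.1 (Nat.pair q.2 n)).map fun m => decide (m = 0)) ?_
      refine Partrec.map (hφ.comp (Computable.fst.comp Computable.fst) ?_) ?_
      · exact (Primrec₂.natPair.comp (Primrec.snd.comp Primrec.fst) Primrec.snd).to_comp
      · exact (Primrec.eq.comp Primrec.snd (Primrec.const 0)).decide.to_comp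
    · intro j k a m hjk hm
      obtain ⟨h0, h1⟩ := mem_rfind_eq_zero.1 hm
      refine mem_rfind_eq_zero.2 ⟨aφ.mono hjk h0, fun i hi => ?_⟩
      obtain ⟨c, hc, h2⟩ := h1 i hi
      exact ⟨c, aφ.mono hjk hc, h2⟩
    · intro a m
      refine (mem_rfind_eq_zero (g := fun n => f (Nat.pair a n))).trans ?_
      constructor
      · rintro ⟨h0, h1⟩
        obtain ⟨j, hj⟩ := aφ.mem_iff.1 h0
        -- The unbounded search inspects only the arguments up to `m`, so the maximum of finitely
        -- many segment lengths suffices.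
        have : ∀ i, ∃ k, i < m → ∃ c ∈ φ (initialSegment B k) (Nat.pair a i), c ≠ 0 := by
          intro i
          by_cases hi : i < m
          · obtain ⟨c, hc, h2⟩ := h1 i hi
            obtain ⟨k, hk⟩ := aφ.mem_iff.1 hc
            exact ⟨k, fun _ => ⟨c, hk, h2⟩⟩
          · exact ⟨0, fun h => absurd h hi⟩
        choose K hK using this
        refine ⟨max j ((Finset.range m).sup K), mem_rfind_eq_zero.2
          ⟨aφ.mono (le_max_left _ _) hj, fun i hi => ?_⟩⟩
        obtain ⟨c, hc, h2⟩ := hK i hi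
        exact ⟨c, aφ.mono ((Finset.le_sup (f := K) (Finset.mem_range.2 hi)).trans
          (le_max_right _ _)) hc, h2⟩
      · rintro ⟨k, hm⟩
        obtain ⟨h0, h1⟩ := mem_rfind_eq_zero.1 hm
        refine ⟨aφ.mem_iff.2 ⟨k, h0⟩, fun i hi => ?_⟩
        obtain ⟨c, hc, h2⟩ := h1 i hi
        exact ⟨c, aφ.mem_iff.2 ⟨k, hc⟩, h2⟩

/-- The partial function with code `c`, applied to a list and a number. -/
def evalOn (c : Nat.Partrec.Code) (L : List ℕ) (n : ℕ) : Part ℕ := c.eval (Encodable.encode (L, n))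

/-- A set reducible to `B` is computed from initial segments of `B` by a code. -/
theorem exists_code_of_reducible {A B : Set ℕ} (h : SetTuringReducible A B) :
    ∃ c : Nat.Partrec.Code, ∀ n m,
      m ∈ charFn A n ↔ ∃ k, m ∈ evalOn c (initialSegment B k) n := by
  obtain ⟨φ, hφ, aφ⟩ := exists_approximates (RecursiveIn.iff_nat.1 h)
  obtain ⟨c, hc⟩ := Nat.Partrec.Code.exists_code.1 (show Nat.Partrec _ from hφ)
  refine ⟨c, fun n m => ?_⟩
  have : ∀ L, evalOn c L n = φ L n := by
    intro L
    rw [evalOn, hc]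
    simp [Part.map_id']
  simp only [this]
  exact aφ.mem_iff

/-- A relativised search: `A` is reducible to `B` if membership in `A` is witnessed by computable
families of numbers that are not in `B`. -/
theorem setTuringReducible_of_search {A B : Set ℕ} (hB : B.Nonempty)
    {h : ℕ → Option (ℕ × ℕ × ℕ)} (hh : Computable h)
    (hA : ∀ n m, m ∈ charFn A n ↔ ∃ s q, h s = some (n, m, q) ∧ q ∉ B) :
    SetTuringReducible A B := by
  obtain ⟨d, hd⟩ := hB
  -- The default query `d` lies in `B`, so steps that find nothing or concern another argument never
  -- stop the search.
  let Q : ℕ → ℕ → ℕ := fun n s =>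
    Option.casesOn (h s) d fun p => if p.1 = n then p.2.2 else d
  let V : ℕ → ℕ := fun s => Option.casesOn (h s) 0 fun p => p.2.1
  have hQ : Computable fun p : ℕ => Q p.unpair.1 p.unpair.2 := by
    refine Computable.option_casesOn (o := fun p : ℕ => h p.unpair.2) (f := fun _ => d)
      (g := fun p q => if q.1 = p.unpair.1 then q.2.2 else d)
      (hh.comp (Computable.snd.comp Computable.unpair)) (Computable.const d) ?_
    exact (Primrec.ite (Primrec.eq.comp (Primrec.fst.comp Primrec.snd)
      (Primrec.fst.comp (Primrec.unpair.comp Primrec.fst)))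
      (Primrec.snd.comp (Primrec.snd.comp Primrec.snd)) (Primrec.const d)).to_comp
  have hV : Computable V :=
    Computable.option_casesOn (o := h) (f := fun _ => 0) (g := fun _ p => p.2.1) hh (Computable.const 0)
      (Computable.fst.comp (Computable.snd.comp Computable.snd))
  have rQ : Nat.RecursiveIn {charFn B} fun p : ℕ => Part.some (Q p.unpair.1 p.unpair.2) :=
    (Partrec.nat_iff.1 hQ.partrec).recursiveIn
  have rV : Nat.RecursiveIn {charFn B} fun s : ℕ => Part.some (V s) :=
    (Partrec.nat_iff.1 hV.partrec).recursiveIn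
  have rS := Nat.RecursiveIn.rfind ((Nat.RecursiveIn.oracle (charFn B) (Set.mem_singleton _)).comp rQ)
  refine RecursiveIn.iff_nat.2 ((rV.comp rS).of_eq fun n => ?_)
  have hchar : ∀ m, m ∈ charFn A n ↔ m = open Classical in if n ∈ A then 1 else 0 := fun m =>
    Part.mem_some_iff
  have hcharB : ∀ q, (0 ∈ charFn B q ↔ q ∉ B) := by
    intro q
    by_cases hq : q ∈ B <;> simp [charFn, hq]
  have hQB : ∀ s, Q n s ∉ B ↔ ∃ m q, h s = some (n, m, q) ∧ q ∉ B := by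
    intro s
    rcases hs : h s with _ | ⟨a, m, q⟩
    · simp [Q, hs, hd]
    · by_cases ha : a = n
      · subst ha; simp [Q, hs]
      · simp [Q, hs, ha, hd]
  have hcharB1 : ∀ q ∈ B, 1 ∈ charFn B q := fun q hq => by simp [charFn, hq]
  let S : Part ℕ := Nat.rfind fun s => (charFn B (Q n s)).map fun m => decide (m = 0)
  obtain ⟨s, hs⟩ : ∃ s, s ∈ S := by
    classical
    obtain ⟨s, q, hs, hq⟩ := (hA n _).1 ((hchar _).2 rfl)
    have hex : ∃ s, Q n s ∉ B := ⟨s, (hQB s).2 ⟨_, q, hs, hq⟩⟩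
    refine ⟨Nat.find hex, mem_rfind_eq_zero.2 ⟨(hcharB _).2 (Nat.find_spec hex), fun i hi => ?_⟩⟩
    exact ⟨1, hcharB1 _ (not_not.1 (Nat.find_min hex hi)), one_ne_zero⟩
  obtain ⟨m, q, hsm, hq⟩ := (hQB s).1 ((hcharB _).1 (mem_rfind_eq_zero.1 hs).1)
  have hm := (hA n m).2 ⟨s, q, hsm, hq⟩
  have hVs : V s = m := by simp [V, hsm]
  have hS : (Nat.rfind fun s => ((Part.some (Q (Nat.unpair (Nat.pair n s)).1
      (Nat.unpair (Nat.pair n s)).2)).bind (charFn B)).map fun m => decide (m = 0)) = S := by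
    congr
    funext s
    rw [Nat.unpair_pair]
    exact congrArg _ (Part.bind_some _ (charFn B))
  change Part.bind (Nat.rfind fun s => ((Part.some (Q (Nat.unpair (Nat.pair n s)).1
    (Nat.unpair (Nat.pair n s)).2)).bind (charFn B)).map fun m => decide (m = 0))
    (fun s => Part.some (V s)) = _
  rw [hS, Part.eq_some_iff.2 hs, Part.bind_some, hVs]
  exact (Part.eq_some_iff.2 hm).symm

/-! ### Membership and solvability in `R_W`. -/

theorem mem_subringOf_iff {W : Nat.Primes → Bool} {x : ℚ} :
    x ∈ subringOf W ↔ ∀ p : Nat.Primes, (p : ℕ) ∣ x.den → W p = true := by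
  constructor
  · intro hx
    have hdvd : ∀ {a b c : ℚ} {p : Nat.Primes}, c.den ∣ a.den * b.den →
        (∀ q : Nat.Primes, (q : ℕ) ∣ a.den → W q = true) →
        (∀ q : Nat.Primes, (q : ℕ) ∣ b.den → W q = true) → (p : ℕ) ∣ c.den → W p = true :=
      fun {_ _ _ p} h ha hb hp => (p.2.dvd_mul.1 (hp.trans h)).elim (ha _) (hb _)
    refine Subring.closure_induction (p := fun x _ => ∀ q : Nat.Primes, (q : ℕ) ∣ x.den → W q = true)
      ?_ ?_ ?_ ?_ ?_ ?_ hx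
    · rintro x ⟨q, hq, rfl⟩ p hp
      have : (1 / ((q : ℕ) : ℚ)).den = q := by
        rw [one_div, Rat.inv_natCast_den_of_pos q.2.pos]
      rw [this] at hp
      obtain rfl : p = q := Subtype.ext ((Nat.prime_dvd_prime_iff_eq p.2 q.2).1 hp)
      exact hq
    · exact fun p hp => absurd (Nat.dvd_one.1 hp) p.2.ne_one
    · exact fun p hp => absurd (Nat.dvd_one.1 hp) p.2.ne_one
    · exact fun x y _ _ hx hy p hp => hdvd (Rat.add_den_dvd x y) hx hy hp
    · exact fun x _ hx p hp => hx p (by simpa using hp)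
    · exact fun x y _ _ hx hy p hp => hdvd (Rat.mul_den_dvd x y) hx hy hp
  · intro h
    have inv : ∀ n : ℕ, n ≠ 0 → (∀ p : Nat.Primes, (p : ℕ) ∣ n → W p = true) →
        (1 / n : ℚ) ∈ subringOf W := by
      intro n
      induction n using induction_on_primes with
      | zero => exact fun h => absurd rfl h
      | one => intro _ _; simp
      | prime_mul p a hp ih =>
        intro hne hW
        have h1 : (1 / p : ℚ) ∈ subringOf W :=
          Subring.subset_closure ⟨⟨p, hp⟩, hW ⟨p, hp⟩ (dvd_mul_right _ _), rfl⟩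
        have h2 := ih (right_ne_zero_of_mul hne) fun q hq => hW q (hq.mul_left _)
        have : (1 / ((p * a : ℕ) : ℚ)) = 1 / p * (1 / a) := by push_cast; rw [one_div_mul_one_div]
        rw [this]
        exact (subringOf W).mul_mem h1 h2
    have : x = x.num * (1 / x.den) := by rw [mul_one_div, Rat.num_div_den]
    rw [this]
    exact (subringOf W).mul_mem (intCast_mem _ _) (inv _ x.den_nz h)

theorem mem_HTP_subringOf {W : Nat.Primes → Bool} {t : Terms} :
    polyOfTerms t ∈ HTP (subringOf W) ↔ SolvableIn (subringOf W) t := by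
  have key : ∀ r : ℕ → subringOf W, MvPolynomial.aeval r (polyOfTerms t) = 0 ↔
      evalTerms (fun i => (r i : ℚ)) t = 0 := by
    intro r
    have := MvPolynomial.comp_aeval_apply (r) ((subringOf W).subtype.toIntAlgHom) (polyOfTerms t)
    rw [← aeval_polyOfTerms]
    change _ ↔ MvPolynomial.aeval (fun i => (subringOf W).subtype.toIntAlgHom (r i)) _ = 0
    rw [← this]
    exact (map_eq_zero_iff (subringOf W).subtype.toIntAlgHom Subtype.val_injective).symm
  constructor
  · rintro ⟨r, hr⟩
    exact ⟨fun i => r i, fun i => (r i).2, (key r).1 hr⟩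
  · rintro ⟨v, hv, h⟩
    exact ⟨fun i => ⟨v i, hv i⟩, (key _).2 h⟩

theorem mem_HTP_rat {t : Terms} : polyOfTerms t ∈ HTP ℚ ↔ SolvableIn Set.univ t :=
  exists_congr fun v => by simp [aeval_polyOfTerms]

/-! ### Cylinders -/

/-- The class of all `W` that contain the primes dividing `N` and omit those dividing `K`. -/
def cylinder (N K : ℕ) : Set (Nat.Primes → Bool) :=
  {W | (∀ p : Nat.Primes, (p : ℕ) ∣ N → W p = true) ∧ ∀ p : Nat.Primes, (p : ℕ) ∣ K → W p = false}

theorem cylinder_subset {N K N' K' : ℕ} (hN : N ∣ N') (hK : K ∣ K') :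
    cylinder N' K' ⊆ cylinder N K :=
  fun _ h => ⟨fun p hp => h.1 p (hp.trans hN), fun p hp => h.2 p (hp.trans hK)⟩

theorem finite_primes_dvd {N : ℕ} (hN : N ≠ 0) : {p : Nat.Primes | (p : ℕ) ∣ N}.Finite :=
  Set.Finite.preimage (f := fun p : Nat.Primes => (p : ℕ)) Subtype.val_injective.injOn
    (s := {n | n ∣ N}) ((Set.finite_Iic N).subset fun _ h => Nat.le_of_dvd (Nat.pos_of_ne_zero hN) h)

theorem isOpen_cylinder {N K : ℕ} (hN : N ≠ 0) (hK : K ≠ 0) : IsOpen (cylinder N K) := by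
  have h : ∀ (n : ℕ) (b : Bool), n ≠ 0 →
      IsOpen {W : Nat.Primes → Bool | ∀ p : Nat.Primes, (p : ℕ) ∣ n → W p = b} := by
    intro n b hn
    have : {W : Nat.Primes → Bool | ∀ p : Nat.Primes, (p : ℕ) ∣ n → W p = b} =
        ⋂ p ∈ {p : Nat.Primes | (p : ℕ) ∣ n}, (fun W => W p) ⁻¹' {b} := by
      ext W; simp
    rw [this]
    exact (finite_primes_dvd hn).isOpen_biInter fun p _ =>
      (isOpen_discrete _).preimage (continuous_apply p)
  exact (h N true hN).inter (h K false hK)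

theorem cylinder_nonempty {N K : ℕ} (h : N.Coprime K) : (cylinder N K).Nonempty := by
  classical
  refine ⟨fun p => decide ((p : ℕ) ∣ N), fun p hp => by simpa using hp, fun p hp => ?_⟩
  simp only [decide_eq_false_iff_not]
  exact fun hN => p.2.ne_one (Nat.eq_one_of_dvd_coprimes h hN hp)

theorem coprime_of_mem_cylinder {N K : ℕ} {W : Nat.Primes → Bool} (h : W ∈ cylinder N K) :
    N.Coprime K := by
  refine Nat.coprime_of_dvd fun p hp hN hK => ?_
  have h1 := h.1 ⟨p, hp⟩ hN
  have h2 := h.2 ⟨p, hp⟩ hK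
  rw [h1] at h2
  exact Bool.noConfusion h2

/-- A basic open set fixes finitely many coordinates; `N` and `K` are the products of those primes
that `W` contains, respectively omits. -/
theorem exists_cylinder_subset {U : Set (Nat.Primes → Bool)} (hU : IsOpen U)
    {W : Nat.Primes → Bool} (hW : W ∈ U) :
    ∃ N K : ℕ, N ≠ 0 ∧ K ≠ 0 ∧ W ∈ cylinder N K ∧ cylinder N K ⊆ U := by
  classical
  obtain ⟨I, u, hu, hIU⟩ := isOpen_pi_iff.1 hU W hW
  have prime_mem : ∀ (S : Finset Nat.Primes) (p : Nat.Primes), (p : ℕ) ∣ ∏ q ∈ S, (q : ℕ) ↔ p ∈ S := by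
    intro S p
    constructor
    · intro h
      obtain ⟨q, hq, hpq⟩ := (Prime.dvd_finsetProd_iff p.2.prime _).1 h
      rwa [show p = q from Subtype.ext ((Nat.prime_dvd_prime_iff_eq p.2 q.2).1 hpq)]
    · exact fun h => Finset.dvd_prod_of_mem (fun q : Nat.Primes => (q : ℕ)) h
  refine ⟨∏ q ∈ I.filter (fun q => W q = true), (q : ℕ),
    ∏ q ∈ I.filter (fun q => W q = false), (q : ℕ),
    Finset.prod_ne_zero_iff.2 fun q _ => q.2.ne_zero,
    Finset.prod_ne_zero_iff.2 fun q _ => q.2.ne_zero, ⟨fun p hp => ?_, fun p hp => ?_⟩, ?_⟩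
  · exact (Finset.mem_filter.1 ((prime_mem _ _).1 hp)).2
  · exact (Finset.mem_filter.1 ((prime_mem _ _).1 hp)).2
  · intro V hV
    refine hIU fun p hp => ?_
    have : V p = W p := by
      cases h : W p
      · exact hV.2 p ((prime_mem _ _).2 (Finset.mem_filter.2 ⟨hp, h⟩))
      · exact hV.1 p ((prime_mem _ _).2 (Finset.mem_filter.2 ⟨hp, h⟩))
    rw [this]
    exact (hu p hp).2

/-! ### Certificates for solvability in `R_W` -/

/-- Allowing every nonzero multiple of `N` as denominator lets several positive certificates share
one denominator. -/
theorem exists_numerators {W : Nat.Primes → Bool} {t : Terms} (h : SolvableIn (subringOf W) t) :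
    ∃ N : ℕ, N ≠ 0 ∧ (∀ p : Nat.Primes, (p : ℕ) ∣ N → W p = true) ∧ ∀ N' : ℕ, N' ≠ 0 → N ∣ N' →
      ∃ x : List ℤ, evalTerms (fun i => (x.getD i 0 : ℚ) / N') t = 0 := by
  classical
  obtain ⟨v, hv, h0⟩ := h
  obtain ⟨d, hd, hint, hp⟩ := exists_common_den v (varsTerms t)
  choose! k hk using hint
  refine ⟨d, hd.ne', fun p hpd => ?_, ?_⟩
  · obtain ⟨i, -, hi⟩ := hp p p.2 hpd
    exact mem_subringOf_iff.1 (hv i) p hi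
  · rintro _ hN ⟨c, rfl⟩
    have hd' : (d : ℚ) ≠ 0 := by exact_mod_cast hd.ne'
    have hc' : (c : ℚ) ≠ 0 := by exact_mod_cast right_ne_zero_of_mul hN
    refine ⟨(List.range ((varsTerms t).toFinset.sup id + 1)).map fun i => k i * c, ?_⟩
    rw [← h0]
    refine evalTerms_congr fun i hi => ?_
    have hlt : i < (varsTerms t).toFinset.sup id + 1 :=
      Nat.lt_succ_of_le (Finset.le_sup (f := id) (List.mem_toFinset.2 hi))
    rw [List.getD_eq_getElem?_getD, List.getElem?_map, List.getElem?_range hlt]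
    simp only [Option.map_some, Option.getD_some]
    push_cast
    rw [← hk i hi]
    field_simp

theorem solvableIn_of_numerators {W : Nat.Primes → Bool} {t : Terms} {N : ℕ}
    (hW : ∀ p : Nat.Primes, (p : ℕ) ∣ N → W p = true) {x : List ℤ}
    (h : evalTerms (fun i => (x.getD i 0 : ℚ) / N) t = 0) : SolvableIn (subringOf W) t := by
  refine ⟨_, fun i => mem_subringOf_iff.2 fun p hp => hW p ?_, h⟩
  have hd := Rat.den_dvd (x.getD i 0) N
  rw [Rat.divInt_eq_div, Int.cast_natCast] at hd
  exact hp.trans (by exact_mod_cast hd)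

theorem subringOf_subset_localSet {W : Nat.Primes → Bool} {r M : ℕ} (hr4 : r % 4 = 1) (hM : M ≠ 0)
    (hrM : r.Coprime M) (hW : ∀ p : Nat.Primes, (p : ℕ) ∣ r * M → W p = false) :
    (subringOf W : Set ℚ) ⊆ localSet r M := by
  intro x hx
  refine mem_localSet hr4 (Nat.pos_of_ne_zero hM) hrM (Nat.coprime_of_dvd fun p hp h1 h2 => ?_)
  have h3 := mem_subringOf_iff.1 hx ⟨p, hp⟩ h1
  rw [hW ⟨p, hp⟩ h2] at h3
  exact Bool.noConfusion h3

/-! ### Generic sets of primes decide every polynomial. -/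

/-- The class of all `W` for which the (un)solvability of `t` in `R_W` has a finite reason. -/
def decidedClass (t : Terms) : Set (Nat.Primes → Bool) :=
  {W | SolvableIn (subringOf W) t} ∪
    {W | ∃ r M : ℕ, r % 4 = 1 ∧ M ≠ 0 ∧ r.Coprime M ∧ W ∈ cylinder 1 (r * M) ∧
      ¬ SolvableIn (localSet r M) t}

theorem isOpen_decidedClass (t : Terms) : IsOpen (decidedClass t) := by
  refine IsOpen.union ?_ ?_
  · rw [isOpen_iff_forall_mem_open]
    intro W hW
    obtain ⟨N, hN, hWN, h⟩ := exists_numerators hW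
    obtain ⟨x, hx⟩ := h N hN dvd_rfl
    exact ⟨cylinder N 1, fun V hV => solvableIn_of_numerators hV.1 hx,
      isOpen_cylinder hN one_ne_zero, hWN, fun p hp => absurd (Nat.dvd_one.1 hp) p.2.ne_one⟩
  · rw [isOpen_iff_forall_mem_open]
    rintro W ⟨r, M, hr4, hM, hrM, hW, h⟩
    exact ⟨cylinder 1 (r * M), fun V hV => ⟨r, M, hr4, hM, hrM, hV, h⟩,
      isOpen_cylinder one_ne_zero (mul_ne_zero (by omega) hM), hW⟩

/-- Inside a given cylinder, take the largest set `V` of primes. Either `t` is solvable in `R_V`, or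
it is unsolvable in every subset of `R_V`, in particular in a suitable `localSet r M`; then
additionally omitting `r` reaches the decided class. -/
theorem dense_decidedClass (t : Terms) : Dense (decidedClass t) := by
  classical
  rw [dense_iff_inter_open]
  rintro U hU ⟨W, hW⟩
  obtain ⟨N, K, hN, hK, hWc, hsub⟩ := exists_cylinder_subset hU hW
  have hNK := coprime_of_mem_cylinder hWc
  let V : Nat.Primes → Bool := fun p => decide (¬ (p : ℕ) ∣ K)
  have hV : V ∈ cylinder N K := by
    refine ⟨fun p hp => ?_, fun p hp => by simpa [V] using hp⟩
    simp only [V, decide_eq_true_eq]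
    exact fun hK => p.2.ne_one (Nat.eq_one_of_dvd_coprimes hNK hp hK)
  by_cases hs : SolvableIn (subringOf V) t
  · exact ⟨V, hsub hV, Or.inl hs⟩
  have hM0 : (∏ p ∈ K.primeFactors, p) ≠ 0 :=
    Finset.prod_ne_zero_iff.2 fun p hp => (Nat.prime_of_mem_primeFactors hp).ne_zero
  -- The radical of `K`: the descent at the primes of `K` needs a squarefree `M`.
  set M := ∏ p ∈ K.primeFactors, p with hM
  have hMK : M ∣ K := Nat.prod_primeFactors_dvd K
  have hMsq : Squarefree M :=
    Finset.squarefree_prod_of_pairwise_isCoprime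
      (fun p hp q hq hpq => Nat.coprime_iff_isRelPrime.1 ((Nat.coprime_primes
        (Nat.prime_of_mem_primeFactors hp) (Nat.prime_of_mem_primeFactors hq)).2 hpq))
      fun p hp => (Nat.prime_of_mem_primeFactors hp).prime.squarefree
  -- Exceeding `N + K` makes `r` divide neither, so `r` may still be omitted.
  obtain ⟨r, hr, hrB, hr8, hnr⟩ := exists_prime_nonresidue hM0 (N + K)
  have hrN : ¬ r ∣ N := fun h => absurd (Nat.le_of_dvd (Nat.pos_of_ne_zero hN) h) (by omega)
  have hrK : ¬ r ∣ K := fun h => absurd (Nat.le_of_dvd (Nat.pos_of_ne_zero hK) h) (by omega)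
  have hcop : N.Coprime (r * K) :=
    Nat.Coprime.mul_right ((Nat.Prime.coprime_iff_not_dvd hr).2 hrN).symm hNK
  obtain ⟨V', hV'⟩ := cylinder_nonempty hcop
  refine ⟨V', hsub (cylinder_subset dvd_rfl (dvd_mul_left _ _) hV'), Or.inr
    ⟨r, M, by omega, hM0, ((Nat.Prime.coprime_iff_not_dvd hr).2 fun h => hrK (h.trans hMK)),
      cylinder_subset (one_dvd _) (mul_dvd_mul_left r hMK) hV', fun h => hs (h.mono ?_)⟩⟩
  intro x hx
  refine mem_subringOf_iff.2 fun p hp => ?_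
  simp only [V, decide_eq_true_eq]
  intro hpK
  have hpM : (p : ℕ) ∣ M :=
    Finset.dvd_prod_of_mem (fun q => q) (Nat.mem_primeFactors.2 ⟨p.2, hpK, hK⟩)
  exact not_dvd_den_of_mem_localSet p.2 hMsq hpM hr8 (hnr p p.2 hpM) hx hp

/-! ### Certificates and the search step as computable objects. -/

theorem primrec_coprime : PrimrecRel fun a b : ℕ => a.Coprime b := by
  have hd : PrimrecRel fun a b : ℕ => a ∣ b :=
    (Primrec.eq.comp (Primrec.nat_mod.comp Primrec.snd Primrec.fst) (Primrec.const 0)).of_eq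
      fun p => (Nat.dvd_iff_mod_eq_zero).symm
  have hl : Primrec fun p : ℕ × ℕ => p.2.unpair.1 :=
    Primrec.fst.comp (Primrec.unpair.comp Primrec.snd)
  have hr : Primrec fun p : ℕ × ℕ => p.2.unpair.2 :=
    Primrec.snd.comp (Primrec.unpair.comp Primrec.snd)
  have hR : PrimrecRel fun d y : ℕ => ¬ (d ∣ y.unpair.1 ∧ d ∣ y.unpair.2) ∨ d = 1 :=
    ((hd.comp Primrec.fst hl).and (hd.comp Primrec.fst hr)).not.or
      (Primrec.eq.comp Primrec.fst (Primrec.const 1))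
  -- The pair is packed into one number to serve as the parameter of the bounded quantifier. The
  -- bound `a + b + 1` exceeds the gcd even if an argument is `0`.
  have hall : PrimrecPred fun p : ℕ × ℕ => ∀ d < p.1 + p.2 + 1,
      ¬ (d ∣ (Nat.pair p.1 p.2).unpair.1 ∧ d ∣ (Nat.pair p.1 p.2).unpair.2) ∨ d = 1 :=
    (PrimrecRel.forall_lt hR).comp
      (Primrec.succ.comp (Primrec.nat_add.comp Primrec.fst Primrec.snd))
      (Primrec₂.natPair.comp Primrec.fst Primrec.snd)
  refine hall.of_eq ?_
  rintro ⟨a, b⟩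
  simp only [Nat.unpair_pair]
  constructor
  · intro h
    have h1 : a.gcd b < a + b + 1 := by
      rcases Nat.eq_zero_or_pos a with rfl | ha
      · simp
      · have := Nat.gcd_le_left b ha; omega
    exact (h _ h1).resolve_left (not_not.2 ⟨Nat.gcd_dvd_left a b, Nat.gcd_dvd_right a b⟩)
  · intro h d _
    by_cases hd : d ∣ a ∧ d ∣ b
    · exact Or.inr (Nat.eq_one_of_dvd_coprimes h hd.1 hd.2)
    · exact Or.inl hd

/-- The answer claimed by a certificate. -/
def Cert.bit (c : Cert) : ℕ := Sum.casesOn c (fun _ => 0) fun _ => 1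

/-- The product of the primes at which a certificate imposes a negative condition. -/
def Cert.modulus (c : Cert) : ℕ := Sum.casesOn c (fun p => p.1 * p.2) fun _ => 1

/-- Admissibility of the parameters of a certificate. -/
def Cert.Good (c : Cert) : Prop :=
  ∀ p, c = Sum.inl p → p.1 % 4 = 1 ∧ p.2 ≠ 0 ∧ p.1.Coprime p.2

theorem Cert.primrec_bit : Primrec Cert.bit :=
  Primrec.sumCasesOn (f := fun c : Cert => c) (g := fun _ _ => 0) (h := fun _ _ => 1)
    Primrec.id (Primrec.const _) (Primrec.const _)

theorem Cert.primrec_modulus : Primrec Cert.modulus :=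
  Primrec.sumCasesOn (f := fun c : Cert => c) (g := fun _ p => p.1 * p.2) (h := fun _ _ => 1)
    Primrec.id (Primrec.nat_mul.comp (Primrec.fst.comp Primrec.snd) (Primrec.snd.comp Primrec.snd))
    (Primrec.const _)

theorem Cert.primrecPred_good : PrimrecPred Cert.Good := by
  classical
  have h : PrimrecPred fun p : ℕ × ℕ => p.1 % 4 = 1 ∧ p.2 ≠ 0 ∧ p.1.Coprime p.2 :=
    (Primrec.eq.comp (Primrec.nat_mod.comp Primrec.fst (Primrec.const 4)) (Primrec.const 1)).and
      ((Primrec.eq.comp Primrec.snd (Primrec.const 0)).not.and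
        (primrec_coprime.comp Primrec.fst Primrec.snd))
  have hb : Primrec fun c : Cert => (Sum.casesOn c (fun p =>
      decide (p.1 % 4 = 1 ∧ p.2 ≠ 0 ∧ p.1.Coprime p.2)) fun _ => true : Bool) :=
    Primrec.sumCasesOn (f := fun c : Cert => c)
      (g := fun _ p => decide (p.1 % 4 = 1 ∧ p.2 ≠ 0 ∧ p.1.Coprime p.2)) (h := fun _ _ => true)
      Primrec.id (h.decide.comp Primrec.snd) (Primrec.const _)
  refine (Primrec.eq.comp hb (Primrec.const true)).of_eq fun c => ?_
  rcases c with p | x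
  · simp [Cert.Good]
  · simp [Cert.Good]

/-- The product of the moduli of a list of certificates. -/
def modulusProd (l : List Cert) : ℕ := l.foldr (fun c acc => c.modulus * acc) 1

theorem primrec_modulusProd : Primrec modulusProd :=
  Primrec.list_foldr (f := fun l : List Cert => l) (g := fun _ => 1)
    (h := fun _ q => q.1.modulus * q.2) Primrec.id (Primrec.const _)
    (Primrec.nat_mul.comp (Cert.primrec_modulus.comp (Primrec.fst.comp Primrec.snd))
      (Primrec.snd.comp Primrec.snd))

theorem modulus_dvd_modulusProd {c : Cert} {l : List Cert} (h : c ∈ l) :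
    c.modulus ∣ modulusProd l := by
  induction l with
  | nil => simp at h
  | cons a l ih =>
    have e : modulusProd (a :: l) = a.modulus * modulusProd l := rfl
    rw [e]
    rcases List.mem_cons.1 h with rfl | h
    · exact dvd_mul_right _ _
    · exact (ih h).mul_left _

theorem exists_of_prime_dvd_modulusProd {p : ℕ} (hp : p.Prime) {l : List Cert}
    (h : p ∣ modulusProd l) : ∃ c ∈ l, p ∣ c.modulus := by
  induction l with
  | nil => exact absurd (Nat.dvd_one.1 h) hp.ne_one
  | cons a l ih =>
    have e : modulusProd (a :: l) = a.modulus * modulusProd l := rfl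
    rw [e] at h
    rcases hp.dvd_mul.1 h with h | h
    · exact ⟨a, List.mem_cons_self, h⟩
    · obtain ⟨c, hc, h⟩ := ih h
      exact ⟨c, List.mem_cons_of_mem _ hc, h⟩

theorem modulusProd_ne_zero {l : List Cert} (h : ∀ c ∈ l, c.Good) : modulusProd l ≠ 0 := by
  induction l with
  | nil => exact one_ne_zero
  | cons a l ih =>
    refine mul_ne_zero ?_ (ih fun c hc => h c (List.mem_cons_of_mem _ hc))
    have ha := h a List.mem_cons_self
    rcases a with p | x
    · obtain ⟨h1, h2, -⟩ := ha p rfl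
      exact mul_ne_zero (by omega) h2
    · exact one_ne_zero

/-- The certificates together with the polynomials that they are about. -/
def attach (g : ℕ → Terms) (l : List Cert) : List (Terms × Cert) :=
  (List.range l.length).map fun i => (g i, l.getD i (Sum.inr []))

theorem computable_attach {g : ℕ → Terms} (hg : Computable g) : Computable (attach g) := by
  -- Since `g` is only computable, the list is built by recursion rather than by the primitive
  -- recursive `map`.
  have : Computable fun l : List Cert => (Nat.rec [] (fun i acc =>
      acc ++ [(g i, l.getD i (Sum.inr []))]) l.length : List (Terms × Cert)) := by
    refine Computable.nat_rec (f := fun l : List Cert => l.length)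
      (g := fun _ => ([] : List (Terms × Cert)))
      (h := fun l p => p.2 ++ [(g p.1, l.getD p.1 (Sum.inr []))])
      Computable.list_length (Computable.const _) ?_
    refine Computable.list_concat.comp (Computable.snd.comp Computable.snd) (Computable.pair
      (hg.comp (Computable.fst.comp Computable.snd)) ?_)
    exact ((Primrec.list_getD (Sum.inr [] : Cert)).comp Primrec.fst
      (Primrec.fst.comp Primrec.snd)).to_comp
  refine this.of_eq fun l => ?_
  rw [attach]
  induction l.length with
  | zero => rfl
  | succ n ih => simp only [ih, List.range_succ, List.map_append, List.map_cons, List.map_nil]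

theorem forall_mem_attach {g : ℕ → Terms} {l : List Cert} {P : Terms × Cert → Prop} :
    (∀ p ∈ attach g l, P p) ↔ ∀ i (h : i < l.length), P (g i, l[i]) := by
  simp only [attach, List.forall_mem_map, List.mem_range]
  refine forall₂_congr fun i h => ?_
  rw [List.getD_eq_getElem _ _ h]

/-- Witnesses of the search: a bound on the length of the computation, the argument, a denominator
and a list of certificates. -/
abbrev Witness := (ℕ × ℕ) × ℕ × List Cert

/-- The conditions on a witness, relative to a cylinder. -/
def WitnessGood (N₀ K₀ : ℕ) (w : Witness) : Prop :=
  (N₀ * (w.2.1 + 1)).Coprime (K₀ * modulusProd w.2.2) ∧ ∀ c ∈ w.2.2, c.Good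

theorem primrecPred_witnessGood (N₀ K₀ : ℕ) : PrimrecPred (WitnessGood N₀ K₀) := by
  have h1 : Primrec fun w : Witness => N₀ * (w.2.1 + 1) :=
    Primrec.nat_mul.comp (Primrec.const _) (Primrec.succ.comp (Primrec.fst.comp Primrec.snd))
  have h2 : Primrec fun w : Witness => K₀ * modulusProd w.2.2 :=
    Primrec.nat_mul.comp (Primrec.const _)
      (primrec_modulusProd.comp (Primrec.snd.comp Primrec.snd))
  exact (primrec_coprime.comp h1 h2).and
    ((Cert.primrecPred_good.forall_mem_list).comp (Primrec.snd.comp Primrec.snd))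

open Classical in
/-- One step of the search: the argument, the value and the query for a witness. -/
noncomputable def searchStep (enc : Terms → ℕ) (g : ℕ → Terms) (c : Nat.Partrec.Code) (N₀ K₀ : ℕ)
    (w : Witness) : Option (ℕ × ℕ × ℕ) :=
  bif decide (WitnessGood N₀ K₀ w) then
    (Nat.Partrec.Code.evaln w.1.1 c (Encodable.encode (w.2.2.map Cert.bit, w.1.2))).map fun m =>
      (w.1.2, m, enc (queryTerms (N₀ * (w.2.1 + 1)) (attach g w.2.2)))
  else none

theorem computable_searchStep {enc : Terms → ℕ} (henc : Computable enc) {g : ℕ → Terms}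
    (hg : Computable g) (c : Nat.Partrec.Code) (N₀ K₀ : ℕ) :
    Computable (searchStep enc g c N₀ K₀) := by
  classical
  unfold searchStep
  refine Computable.cond (primrecPred_witnessGood N₀ K₀).decide.to_comp ?_ (Computable.const _)
  refine Computable.option_map ?_ ?_
  · refine (Nat.Partrec.Code.primrec_evaln.comp (Primrec.pair (Primrec.pair
      (Primrec.fst.comp Primrec.fst) (Primrec.const c)) (Primrec.encode.comp
        (Primrec.pair ?_ (Primrec.snd.comp Primrec.fst))))).to_comp
    exact Primrec.list_map (Primrec.snd.comp Primrec.snd) (Cert.primrec_bit.comp Primrec.snd)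
  · refine Computable.pair (Computable.snd.comp (Computable.fst.comp Computable.fst))
      (Computable.pair Computable.snd (henc.comp (primrec_queryTerms.to_comp.comp ?_ ?_)))
    · exact (Primrec.nat_mul.comp (Primrec.const _) (Primrec.succ.comp
        (Primrec.fst.comp (Primrec.snd.comp Primrec.fst)))).to_comp
    · exact (computable_attach hg).comp (Computable.snd.comp (Computable.snd.comp Computable.fst))

theorem searchStep_eq_some {enc : Terms → ℕ} {g : ℕ → Terms} {c : Nat.Partrec.Code} {N₀ K₀ : ℕ}
    {w : Witness} {n m q : ℕ} : searchStep enc g c N₀ K₀ w = some (n, m, q) ↔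
      WitnessGood N₀ K₀ w ∧
        m ∈ Nat.Partrec.Code.evaln w.1.1 c (Encodable.encode (w.2.2.map Cert.bit, w.1.2)) ∧
        n = w.1.2 ∧ q = enc (queryTerms (N₀ * (w.2.1 + 1)) (attach g w.2.2)) := by
  classical
  unfold searchStep
  by_cases h : WitnessGood N₀ K₀ w
  · simp only [h, decide_true, cond_true, Option.map_eq_some_iff, Prod.mk.injEq, true_and,
      Option.mem_def]
    constructor
    · rintro ⟨a, ha, rfl, rfl, rfl⟩
      exact ⟨ha, rfl, rfl⟩
    · rintro ⟨ha, rfl, rfl⟩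
      exact ⟨m, ha, rfl, rfl, rfl⟩
  · simp [h]

/-! ### Computing `C` from `HTP(ℚ)`. -/

/-- A generic `W` has correct certificates for every polynomial. -/
theorem exists_cert {W : Nat.Primes → Bool} {t : Terms} (hW : W ∈ decidedClass t) :
    ∃ N : ℕ, N ≠ 0 ∧ (∀ p : Nat.Primes, (p : ℕ) ∣ N → W p = true) ∧ ∀ N' : ℕ, N' ≠ 0 → N ∣ N' →
      ∃ c : Cert, c.Good ∧ (∀ p : Nat.Primes, (p : ℕ) ∣ c.modulus → W p = false) ∧
        CertHolds N' (t, c) := by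
  rcases hW with h | ⟨r, M, hr4, hM, hrM, hWc, hn⟩
  · obtain ⟨N, hN, hWN, hx⟩ := exists_numerators h
    refine ⟨N, hN, hWN, fun N' hN' hd => ?_⟩
    obtain ⟨x, hx⟩ := hx N' hN' hd
    refine ⟨Sum.inr x, fun p hp => (nomatch hp), fun p hp =>
      absurd (Nat.dvd_one.1 hp) p.2.ne_one, fun r M h => (nomatch h), fun y hy => ?_⟩
    cases hy
    exact hx
  · refine ⟨1, one_ne_zero, fun p hp => absurd (Nat.dvd_one.1 hp) p.2.ne_one, fun N' _ _ =>
      ⟨Sum.inl (r, M), fun p hp => ?_, hWc.2, fun r' M' h => ?_, fun y hy => (nomatch hy)⟩⟩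
    · cases hp; exact ⟨hr4, hM, hrM⟩
    · cases h; exact hn

/-- Correct certificates tell the truth about `R_W`. -/
theorem bit_eq_of_certHolds {W : Nat.Primes → Bool} {N : ℕ} {t : Terms} {c : Cert}
    (hN : ∀ p : Nat.Primes, (p : ℕ) ∣ N → W p = true) (hg : c.Good)
    (hc : ∀ p : Nat.Primes, (p : ℕ) ∣ c.modulus → W p = false) (h : CertHolds N (t, c)) :
    (SolvableIn (subringOf W) t → c.bit = 1) ∧ (¬ SolvableIn (subringOf W) t → c.bit = 0) := by
  rcases c with ⟨r, M⟩ | x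
  · obtain ⟨h1, h2, h3⟩ := hg _ rfl
    have := mt (SolvableIn.mono (subringOf_subset_localSet h1 h2 h3 hc)) (h.1 r M rfl)
    exact ⟨fun hs => absurd hs this, fun _ => rfl⟩
  · exact ⟨fun _ => rfl, fun hs => absurd (solvableIn_of_numerators hN (h.2 x rfl)) hs⟩

theorem initialSegment_eq {e : ℕ ≃ MvPolynomial ℕ ℤ} {g : ℕ → Terms}
    (hg : ∀ n, polyOfTerms (g n) = e n) {W : Nat.Primes → Bool} {N : ℕ} {l : List Cert}
    (hN : ∀ p : Nat.Primes, (p : ℕ) ∣ N → W p = true) (hgood : ∀ c ∈ l, c.Good)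
    (hmod : ∀ p : Nat.Primes, (p : ℕ) ∣ modulusProd l → W p = false)
    (h : ∀ p ∈ attach g l, CertHolds N p) :
    initialSegment (HTPCodes e (subringOf W)) l.length = l.map Cert.bit := by
  refine List.ext_getElem (by simp [initialSegment]) fun i h1 h2 => ?_
  have hi : i < l.length := by simpa using h2
  have hmem : i ∈ HTPCodes e (subringOf W) ↔ SolvableIn (subringOf W) (g i) := by
    rw [← mem_HTP_subringOf, hg]; rfl
  have hb := bit_eq_of_certHolds hN (hgood _ (List.getElem_mem hi))
    (fun p hp => hmod p (hp.trans (modulus_dvd_modulusProd (List.getElem_mem hi))))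
    (forall_mem_attach.1 h i hi)
  simp only [initialSegment, List.getElem_map]
  split_ifs with hs <;> rw [List.getElem_range, hmem] at hs
  · exact (hb.1 hs).symm
  · exact (hb.2 hs).symm

/-- The search succeeds because a generic `W ∈ S` supplies certificates for the finitely many oracle
bits used. It never errs because different witnesses need not come from the same `W`: each defines a
nonempty subcylinder, which meets `S`, and every member of `S` yields the same set `C`. -/
theorem reducible_of_mem_closure {e : ℕ ≃ MvPolynomial ℕ ℤ} (he : IsComputableCoding e)
    {g : ℕ → Terms} (hgc : Computable g) (hg : ∀ n, polyOfTerms (g n) = e n) {C : Set ℕ}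
    {c : Nat.Partrec.Code} {S : Set (Nat.Primes → Bool)}
    (hS : ∀ W ∈ S, ∀ n m, m ∈ charFn C n ↔
      ∃ k, m ∈ evalOn c (initialSegment (HTPCodes e (subringOf W)) k) n)
    (hgen : ∀ W ∈ S, ∀ i, W ∈ decidedClass (g i)) {N₀ K₀ : ℕ} (hN₀ : N₀ ≠ 0) (hK₀ : K₀ ≠ 0)
    (hcop : N₀.Coprime K₀) (hcl : cylinder N₀ K₀ ⊆ closure S) :
    SetTuringReducible C (HTPCodes e ℚ) := by
  have hmemQ : ∀ t : Terms, e.symm (polyOfTerms t) ∈ HTPCodes e ℚ ↔ SolvableIn Set.univ t := by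
    intro t
    rw [← mem_HTP_rat]
    change e (e.symm (polyOfTerms t)) ∈ HTP ℚ ↔ _
    rw [Equiv.apply_symm_apply]
  have hmeet : ∀ N K : ℕ, N₀ ∣ N → K₀ ∣ K → N ≠ 0 → K ≠ 0 → N.Coprime K →
      ∃ W ∈ S, W ∈ cylinder N K := by
    intro N K hN hK hN0 hK0 hNK
    obtain ⟨V, hV⟩ := cylinder_nonempty hNK
    obtain ⟨W, hW, hWS⟩ := mem_closure_iff.1 (hcl (cylinder_subset hN hK hV)) _
      (isOpen_cylinder hN0 hK0) hV
    exact ⟨W, hWS, hW⟩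
  refine setTuringReducible_of_search
    (h := fun s => (Encodable.decode s : Option Witness).bind
      (searchStep (fun t => e.symm (polyOfTerms t)) g c N₀ K₀))
    ⟨e.symm 0, 0, by simp⟩ ?_ fun n m => ?_
  · exact Computable.option_bind Computable.decode
      ((computable_searchStep he.encode hgc c N₀ K₀).comp Computable.snd)
  constructor
  · intro hm
    obtain ⟨W, hWS, hW⟩ := hmeet N₀ K₀ dvd_rfl dvd_rfl hN₀ hK₀ hcop
    obtain ⟨k, hk⟩ := (hS W hWS n m).1 hm
    choose N hN hWN hcert using fun i => exists_cert (hgen W hWS i)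
    -- One denominator for all positive certificates. Including `N₀` in it lets a single number also
    -- record the positive half of the cylinder.
    set P := ∏ i ∈ Finset.range k, N i with hP
    have hP0 : P ≠ 0 := Finset.prod_ne_zero_iff.2 fun i _ => hN i
    have hWP : ∀ p : Nat.Primes, (p : ℕ) ∣ N₀ * P → W p = true := by
      intro p hp
      rcases p.2.dvd_mul.1 hp with hp | hp
      · exact hW.1 p hp
      · obtain ⟨i, -, hi⟩ := (Prime.dvd_finsetProd_iff p.2.prime _).1 hp
        exact hWN i p hi
    have hcert' : ∀ i, ∃ c : Cert, i < k → c.Good ∧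
        (∀ p : Nat.Primes, (p : ℕ) ∣ c.modulus → W p = false) ∧ CertHolds (N₀ * P) (g i, c) := by
      intro i
      by_cases hi : i < k
      · obtain ⟨c, hc⟩ := hcert i (N₀ * P) (mul_ne_zero hN₀ hP0)
          ((Finset.dvd_prod_of_mem N (Finset.mem_range.2 hi)).mul_left _)
        exact ⟨c, fun _ => hc⟩
      · exact ⟨Sum.inr [], fun h => absurd h hi⟩
    choose cert hcert' using hcert'
    set l := (List.range k).map cert with hl
    have hlen : l.length = k := by simp [hl]
    have hgood : ∀ c ∈ l, c.Good := by
      intro c hc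
      obtain ⟨i, hi, rfl⟩ := List.mem_map.1 hc
      exact (hcert' i (List.mem_range.1 hi)).1
    have hmod : ∀ p : Nat.Primes, (p : ℕ) ∣ modulusProd l → W p = false := by
      intro p hp
      obtain ⟨c, hc, hpc⟩ := exists_of_prime_dvd_modulusProd p.2 hp
      obtain ⟨i, hi, rfl⟩ := List.mem_map.1 hc
      exact (hcert' i (List.mem_range.1 hi)).2.1 p hpc
    have hholds : ∀ p ∈ attach g l, CertHolds (N₀ * P) p := by
      refine forall_mem_attach.2 fun i hi => ?_
      have : l[i] = cert i := by simp [hl]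
      rw [this]
      exact (hcert' i (hlen ▸ hi)).2.2
    -- A witness stores the denominator minus one, so that every stored number is admissible.
    have hP1 : P - 1 + 1 = P := Nat.succ_pred_eq_of_ne_zero hP0
    rw [← hlen, initialSegment_eq hg hWP hgood hmod hholds] at hk
    obtain ⟨f, hf⟩ := Nat.Partrec.Code.evaln_complete.1 hk
    refine ⟨Encodable.encode (((f, n), P - 1, l) : Witness),
      e.symm (polyOfTerms (queryTerms (N₀ * (P - 1 + 1)) (attach g l))), ?_, ?_⟩
    · rw [Encodable.encodek, Option.bind_some]
      refine searchStep_eq_some (w := ((f, n), P - 1, l)).2 ⟨⟨?_, hgood⟩, hf, rfl, rfl⟩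
      dsimp only
      rw [hP1]
      refine coprime_of_mem_cylinder (W := W) ⟨hWP, fun p hp => ?_⟩
      exact (p.2.dvd_mul.1 hp).elim (hW.2 p) (hmod p)
    · rw [hmemQ, hP1]
      exact (not_solvableIn_queryTerms (mul_ne_zero hN₀ hP0) _).2 hholds
  · rintro ⟨s, q, hs, hq⟩
    obtain ⟨⟨⟨f, n'⟩, a, l⟩, -, hw⟩ := Option.bind_eq_some_iff.1 hs
    obtain ⟨⟨hco, hgood⟩, hev, rfl, rfl⟩ := searchStep_eq_some.1 hw
    dsimp only at hco hgood hev hq ⊢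
    have hN : N₀ * (a + 1) ≠ 0 := mul_ne_zero hN₀ a.succ_ne_zero
    rw [hmemQ, not_solvableIn_queryTerms hN] at hq
    -- For this `W` the certified bits are a true initial segment of its oracle, so the computed
    -- value is that of `C`.
    obtain ⟨W, hWS, hW⟩ := hmeet _ _ (dvd_mul_right _ _) (dvd_mul_right _ _) hN
      (mul_ne_zero hK₀ (modulusProd_ne_zero hgood)) hco
    refine (hS W hWS _ m).2 ⟨l.length, ?_⟩
    rw [initialSegment_eq hg hW.1 hgood (fun p hp => hW.2 p (hp.mul_left _)) hq]
    exact Nat.Partrec.Code.evaln_complete.2 ⟨f, hev⟩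

/-- The class is covered by countably many pieces, one for each program, together with the meager
set of nongeneric `W`. Some generic piece is therefore not meager, hence somewhere dense, and its
closure contains a cylinder. -/
theorem reducible_of_not_isMeagre {e : ℕ ≃ MvPolynomial ℕ ℤ} (he : IsComputableCoding e)
    {C : Set ℕ} (h : ¬ IsMeagre (computingClass e C)) : SetTuringReducible C (HTPCodes e ℚ) := by
  obtain ⟨g, hgc, hg⟩ := he.decode
  let A : Nat.Partrec.Code → Set (Nat.Primes → Bool) := fun c => {W | ∀ n m, m ∈ charFn C n ↔
    ∃ k, m ∈ evalOn c (initialSegment (HTPCodes e (subringOf W)) k) n}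
  let G : Set (Nat.Primes → Bool) := ⋂ i, decidedClass (g i)
  have hG : IsMeagre Gᶜ := by
    rw [IsMeagre, compl_compl]
    exact countable_iInter_mem.2 fun i =>
      residual_of_dense_open (isOpen_decidedClass _) (dense_decidedClass _)
  obtain ⟨c, hc⟩ : ∃ c, ¬ IsMeagre (A c ∩ G) := by
    by_contra hcon
    push Not at hcon
    refine h (((isMeagre_iUnion hcon).union hG).mono fun W hW => ?_)
    obtain ⟨c, hc⟩ := exists_code_of_reducible hW
    by_cases hWG : W ∈ G
    · exact Or.inl (Set.mem_iUnion.2 ⟨c, hc, hWG⟩)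
    · exact Or.inr hWG
  have hnd : ¬ IsNowhereDense (A c ∩ G) := fun hn => hc hn.isMeagre
  obtain ⟨W, hW⟩ := Set.nonempty_iff_ne_empty.2 hnd
  obtain ⟨N, K, hN, hK, hWc, hsub⟩ := exists_cylinder_subset isOpen_interior hW
  exact reducible_of_mem_closure he hgc hg (fun W hW => hW.1) (fun W hW => Set.mem_iInter.1 hW.2)
    hN hK (coprime_of_mem_cylinder hWc) (hsub.trans interior_subset)

/-! ### Reduction of `HTP(ℚ)` to `HTP(R_W)` and the equivalences. -/

theorem setTuringReducible_of_computable {A B : Set ℕ} {f : ℕ → ℕ} (hf : Computable f)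
    (h : ∀ n, n ∈ A ↔ f n ∈ B) : SetTuringReducible A B := by
  have rf : Nat.RecursiveIn {charFn B} fun n : ℕ => Part.some (f n) :=
    (Partrec.nat_iff.1 hf.partrec).recursiveIn
  refine RecursiveIn.iff_nat.2
    (((Nat.RecursiveIn.oracle (charFn B) (Set.mem_singleton _)).comp rf).of_eq fun n => ?_)
  refine (Part.bind_some (f n) (charFn B)).trans ?_
  by_cases hn : n ∈ A
  · simp [charFn, hn, (h n).1 hn]
  · simp [charFn, hn, mt (h n).2 hn]

theorem HTPCodes_rat_reducible {e : ℕ ≃ MvPolynomial ℕ ℤ} (he : IsComputableCoding e)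
    (W : Nat.Primes → Bool) : SetTuringReducible (HTPCodes e ℚ) (HTPCodes e (subringOf W)) := by
  obtain ⟨g, hgc, hg⟩ := he.decode
  refine setTuringReducible_of_computable (f := fun n => e.symm (polyOfTerms (projTerms (g n))))
    (he.encode.comp (primrec_projTerms.to_comp.comp hgc)) fun n => ?_
  change e n ∈ HTP ℚ ↔ e (e.symm _) ∈ HTP (subringOf W)
  rw [Equiv.apply_symm_apply, ← hg, mem_HTP_rat, mem_HTP_subringOf,
    solvableIn_projTerms fun k => intCast_mem _ k]

end HTPQ

theorem corollary3p3 (e : ℕ ≃ MvPolynomial ℕ ℤ) (he : HTPQ.IsComputableCoding e) (C : Set ℕ) :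
    List.TFAE
      [HTPQ.SetTuringReducible C (HTPQ.HTPCodes e ℚ),
        HTPQ.computingClass e C = Set.univ,
        IsMeagre (HTPQ.computingClass e C)ᶜ,
        ¬ IsMeagre (HTPQ.computingClass e C)] := by
  tfae_have 1 → 2 := fun h =>
    Set.eq_univ_of_forall fun W => TuringReducible.trans h (HTPQ.HTPCodes_rat_reducible he W)
  tfae_have 2 → 3 := fun h => by
    rw [h, Set.compl_univ]
    exact IsMeagre.empty
  tfae_have 3 → 4 := fun h h' => by
    have := h.union h'
    rw [Set.compl_union_self] at this
    exact not_isMeagre_of_isOpen isOpen_univ Set.univ_nonempty this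
  tfae_have 4 → 1 := HTPQ.reducible_of_not_isMeagre he
  tfae_finish
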